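/- **Theorem 1.1.** Let $\mathbb{L}^2=(\mathbb{Z}^2,\mathcal{E}^2)$ be the square lattice. For a probability vector $\rho=(\rho_0,\rho_1,\rho_2,\rho_3)$, let $(\kappa_v)_{v\in\mathbb{Z}^2}$ be i.i.d. constraints with $\mathbb{P}(\kappa_v=j)=\rho_j$ for $j\in\{0,1,2,3\}$, and let $(U_e)_{e\in\mathcal{E}^2}$ be i.i.d. clocks, uniform on $[0,1]$ and independent of the constraints. In the constrained-degree percolation model all edges are closed at time $0$; an edge $e=\langle u,v\rangle$ attempts to open at time $U_e$, and it opens if and only if, immediately before time $U_e$, the number of open edges incident to $u$ is strictly smaller than $\kappa_u$ and the number of open edges incident to $v$ is strictly smaller than $\kappa_v$; an open edge stays open. This defines, for almost every realization of clocks and constraints, the configuration $\omega_t\in\{0,1\}^{\mathcal{E}^2}$ of edges open at time $t$, for all $t\in[0,1]$. Let $\mathbb{P}_{\rho,t}$ be the law of $\omega_t$, and let $\{0\longleftrightarrow\infty\}$ be the event that the connected component of the origin in the graph of open edges is infinite. There exists a constant $\eta>0$ such that, for every probability vector $\rho=(\rho_0,\rho_1,\rho_2,\rho_3)$ and every $t$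 with $(\rho_3,t)\in(1-\eta,1]^2$, $$\mathbb{P}_{\rho,t}(0\longleftrightarrow\infty)>0.$$ -/

import Mathlib

namespace CDP

open MeasureTheory

/-- The square lattice: vertex set `ℤ²`, edges between vertices at `ℓ¹`-distance one. -/
def lattice : SimpleGraph (ℤ × ℤ) where
  Adj x y := |x.1 - y.1| + |x.2 - y.2| = 1
  symm := ⟨fun x y h => by rwa [abs_sub_comm y.1 x.1, abs_sub_comm y.2 x.2]⟩
  loopless := ⟨fun x h => by simp at h⟩

/-- The edges of the square lattice. -/
abbrev Edge : Type := lattice.edgeSet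

/-- Clock configurations, one time in `[0,1]` for each edge. -/
abbrev Clocks : Type := Edge → unitInterval

/-- Constraint configurations, one number in `{0,1,2,3}` for each vertex. -/
abbrev Constraints : Type := ℤ × ℤ → Fin 4

/-- Bond percolation configurations (`true` is open, `false` is closed). -/
abbrev Config : Type := Edge → Bool

/-- `f` shares an end-vertex with `e` and its clock rings strictly before the clock of `e`. -/
def Earlier (U : Clocks) (f e : Edge) : Prop :=
  (∃ v : ℤ × ℤ, v ∈ f.1 ∧ v ∈ e.1) ∧ U f < U e

/-- The opening rule: given which of the earlier adjacent edges have succeeded in opening, the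
attempt of `e` succeeds iff each end-vertex `v` of `e` has so far fewer than `κ v` open edges. -/
def rule (U : Clocks) (κ : Constraints) (e : Edge)
    (prev : ∀ f : Edge, Earlier U f e → Prop) : Prop :=
  ∀ (v : ℤ × ℤ) (hv : v ∈ e.1),
    {f : Edge | ∃ (hf : v ∈ f.1) (hlt : U f < U e), prev f ⟨⟨v, hf, hv⟩, hlt⟩}.encard
      < ((κ v : ℕ) : ℕ∞)

open Classical in
/-- The attempt of `e` at time `U e` succeeds. This is defined by recursion along `Earlier U`,
which is a well-founded relation for almost every `U` (on the exceptional null set of clock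
configurations no attempt succeeds). -/
noncomputable def Succeeds (U : Clocks) (κ : Constraints) (e : Edge) : Prop :=
  if h : WellFounded (Earlier U) then h.fix (C := fun _ => Prop) (rule U κ) e else False

open Classical in
/-- The configuration `ω_t` at time `t`: an edge is open iff its clock has rung by time `t` and
its attempt to open succeeded. -/
noncomputable def config (t : ℝ) (x : Clocks × Constraints) : Config :=
  fun e => decide ((x.1 e : ℝ) ≤ t ∧ Succeeds x.1 x.2 e)

/-- The degree of `v` immediately before time `s`: the number of edges at `v` that are open at
some time `r < s`. -/
noncomputable def degBefore (x : Clocks × Constraints) (v : ℤ × ℤ) (s : ℝ) : ℕ∞ :=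
  {f : Edge | v ∈ f.1 ∧ ∃ r < s, config r x f = true}.encard

/-- The defining formula
`ω_t(e) = 1{U_e ≤ t} · 1{deg(u, U_e-) < κ_u} · 1{deg(v, U_e-) < κ_v}` for `e = ⟨u,v⟩`. -/
theorem config_eq_true_iff (t : ℝ) (x : Clocks × Constraints)
    (h : WellFounded (Earlier x.1)) (e : Edge) :
    config t x e = true ↔
      (x.1 e : ℝ) ≤ t ∧ ∀ v ∈ e.1, degBefore x v (x.1 e) < ((x.2 v : ℕ) : ℕ∞) := by
  have key : Succeeds x.1 x.2 e ↔ rule x.1 x.2 e (fun f _ => Succeeds x.1 x.2 f) := by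
    simp only [Succeeds, dif_pos h]
    rw [h.fix_eq]
  simp only [config, decide_eq_true_eq, key]
  refine and_congr_right fun _ => forall₂_congr fun v hv => ?_
  have : {f : Edge | ∃ (_ : v ∈ f.1) (_ : x.1 f < x.1 e), Succeeds x.1 x.2 f}
      = {f : Edge | v ∈ f.1 ∧ ∃ r < (x.1 e : ℝ), config r x f = true} := by
    ext f
    simp only [Set.mem_ofPred_eq, config, decide_eq_true_eq, exists_prop]
    refine and_congr_right fun _ => ⟨fun ⟨a, b⟩ => ⟨x.1 f, a, le_rfl, b⟩, ?_⟩
    rintro ⟨r, hr, hle, b⟩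
    exact ⟨Subtype.coe_lt_coe.1 (hle.trans_lt hr), b⟩
  rw [degBefore, ← this]

/-- The joint law of the clocks (i.i.d. uniform on `[0,1]`) and of the constraints (i.i.d. with
law `ρ`), independent of each other. -/
noncomputable def environment (ρ : PMF (Fin 4)) : Measure (Clocks × Constraints) :=
  (Measure.infinitePi fun _ : Edge => (volume : Measure unitInterval)).prod
    (Measure.infinitePi fun _ : ℤ × ℤ => ρ.toMeasure)

/-- The law of `ω_t`. -/
noncomputable def law (ρ : PMF (Fin 4)) (t : ℝ) : Measure Config :=
  (environment ρ).map (config t)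

/-- The subgraph of the square lattice formed by the open edges. -/
def openGraph (ω : Config) : SimpleGraph (ℤ × ℤ) where
  Adj x y := ∃ h : lattice.Adj x y, ω ⟨s(x, y), h⟩ = true
  symm := ⟨fun x y ⟨h, ho⟩ => ⟨h.symm, by simpa only [Sym2.eq_swap] using ho⟩⟩
  loopless := ⟨fun _ ⟨h, _⟩ => h.ne rfl⟩

/-- The open cluster of a vertex. -/
def cluster (ω : Config) (v : ℤ × ℤ) : Set (ℤ × ℤ) :=
  {w | (openGraph ω).Reachable v w}

/-- The event that the open cluster of the origin is infinite. -/
def originPercolates : Set Config :=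
  {ω | (cluster ω (0, 0)).Infinite}

end CDP

/-! If the cluster of a long horizontal segment is finite, its boundary is made of closed edges.
Where clocks have rung by time t and constraints are 3, a closed edge has an end-vertex whose three
other edges opened earlier (`exists_blocking`). Those three edges do not cross the boundary, so this
blocking vertex carries only one boundary edge, and that edge has the latest of the four clocks.
Hence a contour edge with its blocking vertex (a `State`) has just three possible successors: two
straight ones and one turn (`State.step_of_next`).

To bound the probability that all states of a piece of contour block, condition on the clocks of the
contour edges; the competing clocks are then independent. An edge competing at two blocking vertices
must ring before two clocks a and b, and min(a, b) ≤ √a √b, so it can be divided between them in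
halves. A state that receives k halves contributes ∫ u^(k/2) du = 2/(2 + k)
(`State.clockMeasure_blocks_le`). Side edges are allocated whole, the opposite edge only by half.
With this rule the generic weights of the three successors are at most 2/5, 2/7 and 2/7, with sum
34/35 < 1. Contacts with earlier parts of the contour raise some weights, but colours and separation
then rule out successors, and the loss is recovered within a few steps (`State.contourSum_step`). So
long blocked pieces with a given start are exponentially unlikely (`State.contourSum_le`).

Finally the plane is cut into blocks. A block is bad if a blocked piece of length n starts in it, or
if a clock or constraint nearby is defective; choosing n first and η afterwards makes this as
unlikely as desired. The boundary of a finite segment cluster contains a curve from the right half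
of the axis to the left half (`exists_contour`), and every block it visits is bad. Path counting
gives this probability less than 1 (`environment_finite_segmentCluster_lt`). So some vertex
percolates with positive probability, and by translation invariance so does the origin. -/

namespace CDP

open MeasureTheory

/-! ### Unit vectors and rotations. -/

/-- Unit vectors of `ℤ²`. -/
def IsDir (v : ℤ × ℤ) : Prop := |v.1| + |v.2| = 1

/-- Rotation by a right angle. -/
def rot (v : ℤ × ℤ) : ℤ × ℤ := (-v.2, v.1)

theorem isDir_iff {v : ℤ × ℤ} :
    IsDir v ↔ v = (1, 0) ∨ v = (-1, 0) ∨ v = (0, 1) ∨ v = (0, -1) := by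
  obtain ⟨a, b⟩ := v
  simp only [IsDir, Prod.mk.injEq]
  constructor
  · intro h
    rcases abs_cases a with ⟨h1, h2⟩ | ⟨h1, h2⟩ <;> rcases abs_cases b with ⟨h3, h4⟩ | ⟨h3, h4⟩ <;>
      rw [h1, h3] at h <;> omega
  · rintro (⟨rfl, rfl⟩ | ⟨rfl, rfl⟩ | ⟨rfl, rfl⟩ | ⟨rfl, rfl⟩) <;> simp

@[simp] theorem rot_rot (v : ℤ × ℤ) : rot (rot v) = -v := by ext <;> simp [rot]

@[simp] theorem rot_neg (v : ℤ × ℤ) : rot (-v) = -rot v := by ext <;> simp [rot]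

theorem IsDir.neg {v : ℤ × ℤ} (h : IsDir v) : IsDir (-v) := by simpa [IsDir] using h

theorem IsDir.rot {v : ℤ × ℤ} (h : IsDir v) : IsDir (rot v) := by
  simpa [IsDir, CDP.rot, add_comm] using h

theorem IsDir.ne_zero {v : ℤ × ℤ} (h : IsDir v) : v ≠ 0 := by
  rintro rfl; simp [IsDir] at h

theorem IsDir.ne_neg {v : ℤ × ℤ} (h : IsDir v) : v ≠ -v := by
  rw [isDir_iff] at h
  rcases h with rfl | rfl | rfl | rfl <;> simp

theorem IsDir.ne_rot {v : ℤ × ℤ} (h : IsDir v) : v ≠ CDP.rot v := by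
  rw [isDir_iff] at h
  rcases h with rfl | rfl | rfl | rfl <;> simp [CDP.rot]

theorem IsDir.ne_neg_rot {v : ℤ × ℤ} (h : IsDir v) : v ≠ -CDP.rot v := by
  rw [isDir_iff] at h
  rcases h with rfl | rfl | rfl | rfl <;> simp [CDP.rot]

theorem IsDir.cases {d v : ℤ × ℤ} (hd : IsDir d) (hv : IsDir v) :
    v = d ∨ v = -d ∨ v = CDP.rot d ∨ v = -CDP.rot d := by
  rw [isDir_iff] at hd hv
  rcases hd with rfl | rfl | rfl | rfl <;> rcases hv with rfl | rfl | rfl | rfl <;> simp [CDP.rot]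

/-! ### Contour states and consistent pieces of contour. -/

/-- A contour edge `⟨s, s + d⟩` together with the end-vertex `s` that blocked it and the colour
`χ` of `s` (whether `s` lies in the region surrounded by the contour). -/
structure State where
  s : ℤ × ℤ
  d : ℤ × ℤ
  χ : Bool

namespace State

/-- The direction in which the contour is traversed. -/
def τ (x : State) : ℤ × ℤ := if x.χ then rot x.d else -rot x.d

/-- The contour goes straight on, and the blocking vertex stays on the same side. -/
def stepA (x : State) : State := ⟨x.s + x.τ, x.d, x.χ⟩

/-- The contour goes straight on, and the blocking vertex changes sides. -/
def stepB (x : State) : State := ⟨x.s + x.τ + x.d, -x.d, !x.χ⟩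

/-- The contour turns around the end-vertex that is not blocking. -/
def stepC (x : State) : State := ⟨x.s + x.d + x.τ, -x.τ, x.χ⟩

/-- A turn around the blocking vertex cannot occur, as it would give that vertex a second boundary
edge. In a turn around the other end-vertex, that vertex has two boundary edges, so the next
blocking vertex and its colour are forced. -/
def Step (x y : State) : Prop := y = x.stepA ∨ y = x.stepB ∨ y = x.stepC

@[simp] theorem stepA_s (x : State) : x.stepA.s = x.s + x.τ := rfl
@[simp] theorem stepA_d (x : State) : x.stepA.d = x.d := rfl
@[simp] theorem stepA_χ (x : State) : x.stepA.χ = x.χ := rfl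
@[simp] theorem stepA_τ (x : State) : x.stepA.τ = x.τ := rfl
@[simp] theorem stepB_s (x : State) : x.stepB.s = x.s + x.τ + x.d := rfl
@[simp] theorem stepB_d (x : State) : x.stepB.d = -x.d := rfl
@[simp] theorem stepB_χ (x : State) : x.stepB.χ = !x.χ := rfl
@[simp] theorem stepB_τ (x : State) : x.stepB.τ = x.τ := by
  unfold τ; cases h : x.χ <;> simp [h]
@[simp] theorem stepC_s (x : State) : x.stepC.s = x.s + x.d + x.τ := rfl
@[simp] theorem stepC_d (x : State) : x.stepC.d = -x.τ := rfl
@[simp] theorem stepC_χ (x : State) : x.stepC.χ = x.χ := rfl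
@[simp] theorem stepC_τ (x : State) : x.stepC.τ = x.d := by
  unfold stepC τ; cases h : x.χ <;> simp

theorem isDir_τ {x : State} (h : IsDir x.d) : IsDir x.τ := by
  unfold τ; split_ifs
  exacts [h.rot, h.rot.neg]

theorem d_ne_τ {x : State} (h : IsDir x.d) : x.d ≠ x.τ := by
  unfold τ; split_ifs
  exacts [h.ne_rot, h.ne_neg_rot]

theorem d_ne_neg_τ {x : State} (h : IsDir x.d) : x.d ≠ -x.τ := by
  unfold τ; split_ifs
  · exact h.ne_neg_rot
  · simpa using h.ne_rot

theorem dir_cases {x : State} (h : IsDir x.d) {v : ℤ × ℤ} (hv : IsDir v) :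
    v = x.d ∨ v = -x.d ∨ v = x.τ ∨ v = -x.τ := by
  unfold τ
  rcases h.cases hv with h | h | h | h <;> split_ifs <;> simp [h]

/-- A colouring of the lattice fits `x` if `⟨s, s + d⟩` is the only edge at `s` whose end-vertices
have different colours. -/
structure Fits (col : ℤ × ℤ → Bool) (x : State) : Prop where
  self : col x.s = x.χ
  out : col (x.s + x.d) = !x.χ
  side : ∀ v, IsDir v → v ≠ x.d → col (x.s + v) = x.χ

/-- The edges of the two states are different and neither edge touches the blocking vertex of the
other. -/
structure Apart (x y : State) : Prop where
  ne : x.s ≠ y.s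
  left : x.s ≠ y.s + y.d
  right : y.s ≠ x.s + x.d

theorem Apart.symm {x y : State} (h : Apart x y) : Apart y x := ⟨h.ne.symm, h.right, h.left⟩

/-- Lists of states that describe a piece of contour, latest state first. -/
structure Cons (l : List State) : Prop where
  dir : ∀ x ∈ l, IsDir x.d
  chain : l.IsChain fun y x => Step x y
  apart : l.Pairwise Apart
  fits : ∃ col, ∀ x ∈ l, Fits col x

theorem Cons.tail {x : State} {l : List State} (h : Cons (x :: l)) : Cons l :=
  ⟨fun y hy => h.dir y (List.mem_cons_of_mem _ hy), h.chain.tail, h.apart.of_cons,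
    h.fits.imp fun _ hc y hy => hc y (List.mem_cons_of_mem _ hy)⟩

theorem Cons.apart_head {x : State} {l : List State} (h : Cons (x :: l)) {y : State}
    (hy : y ∈ l) : Apart x y := (List.pairwise_cons.1 h.apart).1 y hy

theorem Cons.eq_of_s_eq {l : List State} (h : Cons l) {x y : State} (hx : x ∈ l) (hy : y ∈ l)
    (hs : x.s = y.s) : x = y := by
  by_contra hne
  have : Std.Symm Apart := ⟨fun _ _ h => h.symm⟩
  exact (h.apart.forall hx hy hne).ne hs

/-- Only `i₀` lacks a predecessor, and only the head lacks a successor. Colour arguments can thus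
look one step back or ahead along the contour. -/
theorem exists_step_of_mem_append {l : List State} {i₀ y : State}
    (h : (l ++ [i₀]).IsChain fun y x => Step x y) (hy : y ∈ l) : ∃ z ∈ l ++ [i₀], Step z y := by
  induction l with
  | nil => simp at hy
  | cons a l ih =>
    rw [List.cons_append] at h
    rcases List.mem_cons.1 hy with rfl | hy
    · cases l with
      | nil => exact ⟨i₀, by simp, by simpa using h⟩
      | cons b l => 
        rw [List.cons_append, List.isChain_cons_cons] at h
        exact ⟨b, by simp, h.1⟩
    · obtain ⟨z, hz, hs⟩ := ih h.tail hy
      exact ⟨z, List.mem_cons_of_mem _ hz, hs⟩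

theorem exists_step_to_of_mem {l : List State} {a y : State}
    (h : (a :: l).IsChain fun y x => Step x y) (hy : y ∈ l) : ∃ z ∈ a :: l, Step y z := by
  induction l generalizing a with
  | nil => simp at hy
  | cons b l ih =>
    rw [List.isChain_cons_cons] at h
    rcases List.mem_cons.1 hy with rfl | hy
    · exact ⟨a, by simp, h.1⟩
    · obtain ⟨z, hz, hs⟩ := ih h.2 hy
      exact ⟨z, List.mem_cons_of_mem _ hz, hs⟩

/-! ### Allocation of the edges among blocking vertices. -/

open Classical in
/-- The share (in halves) that the state `x` gets of the edge from `x.s` to a vertex `z` beside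
it, if the states of `l` were served before. -/
noncomputable def sideShare (x : State) (l : List State) (z : ℤ × ℤ) : ℕ :=
  if ∃ y ∈ l, y.s = z ∧ y.s - y.d ≠ x.s then 0 else if ∃ y ∈ l, y.s = z then 1 else 2

open Classical in
/-- The share (in halves) that the state `x` gets of the edge opposite to its own. -/
noncomputable def oppShare (x : State) (l : List State) : ℕ :=
  if ∃ y ∈ l, y.s = x.s - x.d ∧ y.s - y.d ≠ x.s then 0 else 1

/-- Twice the exponent of the clock of `x`. -/
noncomputable def shares (x : State) (l : List State) : ℕ :=
  oppShare x l + sideShare x l (x.s + x.τ) + sideShare x l (x.s - x.τ)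

/-- The integral of u^(k/2) over [0,1] with `k = shares x l`. A state without blocking neighbours
gets 1 + 2 + 2 halves, hence 2/7. -/
noncomputable def weight (x : State) (l : List State) : ℝ := 2 / (2 + shares x l)

theorem weight_pos (x : State) (l : List State) : 0 < weight x l := by
  unfold weight; positivity

theorem weight_le {x : State} {l : List State} {k : ℕ} (h : k ≤ shares x l) :
    weight x l ≤ 2 / (2 + k) := by
  unfold weight; gcongr

theorem weight_le_one (x : State) (l : List State) : weight x l ≤ 1 := by
  simpa using weight_le (Nat.zero_le (shares x l))

theorem sideShare_eq_two {x : State} {l : List State} {z : ℤ × ℤ} (h : ∀ y ∈ l, y.s ≠ z) :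
    sideShare x l z = 2 := by
  rw [sideShare, if_neg, if_neg]
  · rintro ⟨y, hy, h1⟩; exact h y hy h1
  · rintro ⟨y, hy, h1, -⟩; exact h y hy h1

theorem one_le_sideShare {x : State} {l : List State} {z : ℤ × ℤ}
    (h : ∀ y ∈ l, y.s = z → y.s - y.d = x.s) : 1 ≤ sideShare x l z := by
  rw [sideShare, if_neg]
  · split_ifs <;> simp
  · rintro ⟨y, hy, h1, h2⟩; exact h2 (h y hy h1)

theorem oppShare_eq_one {x : State} {l : List State}
    (h : ∀ y ∈ l, y.s = x.s - x.d → y.s - y.d = x.s) : oppShare x l = 1 := by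
  rw [oppShare, if_neg]
  rintro ⟨y, hy, h1, h2⟩; exact h2 (h y hy h1)

/-! ### Consequences of colours and separation. -/

/-- If the next contour vertex may have either colour, it is not adjacent to any blocking
vertex seen so far. -/
theorem ne_of_ambiguous {l : List State} {x : State} (hC : Cons (x.stepC :: l))
    (hAB : Cons (x.stepA :: l) ∨ Cons (x.stepB :: l)) {y : State} (hy : y ∈ l) {v : ℤ × ℤ}
    (hv : IsDir v) : y.s ≠ x.s + x.d + x.τ + v := by
  intro h
  have key : ∃ col, (∀ y ∈ l, Fits col y) ∧ col (x.s + x.d + x.τ) = !x.χ := by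
    rcases hAB with ⟨-, -, -, col, hc⟩ | ⟨-, -, -, col, hc⟩
    · refine ⟨col, fun y hy => hc y (by simp [hy]), ?_⟩
      have := (hc _ List.mem_cons_self).out
      simp only [stepA_s, stepA_d, stepA_χ] at this
      rw [← this]; congr 1; abel
    · refine ⟨col, fun y hy => hc y (by simp [hy]), ?_⟩
      have := (hc _ List.mem_cons_self).self
      simp only [stepB_s, stepB_χ] at this
      rw [← this]; congr 1; abel
  obtain ⟨c₁, h₁, e₁⟩ := key
  obtain ⟨-, -, -, c₂, h₂⟩ := hC
  have e₂ := (h₂ _ List.mem_cons_self).self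
  simp only [stepC_s, stepC_χ] at e₂
  have hp : x.s + x.d + x.τ = y.s + -v := by rw [h]; abel
  rw [hp] at e₁ e₂
  have f₁ := h₁ y hy
  have f₂ := h₂ y (by simp [hy])
  -- `Fits` for `y` fixes the colour of each neighbour of `y.s`, alike under both colourings,
  -- whereas the two continuations require opposite colours.
  by_cases hvd : -v = y.d
  · rw [hvd, f₁.out] at e₁; rw [hvd, f₂.out, e₁] at e₂; simp at e₂
  · rw [f₁.side _ hv.neg hvd] at e₁; rw [f₂.side _ hv.neg hvd, e₁] at e₂; simp at e₂

theorem not_cons_stepA_of_contact {l : List State} {x y : State} (hy : y ∈ l)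
    (h : y.s = x.s + x.τ) : ¬ Cons (x.stepA :: x :: l) := fun hA =>
  (hA.apart_head (List.mem_cons_of_mem _ hy)).ne (by simp [h])

/-- If `y` points along `x.d`, its edge ends at the new blocking vertex. Otherwise the edge from
`y.s` to that vertex does not cross the boundary, so the vertex has the colour of `x`, contrary to
the change of sides. -/
theorem not_cons_stepB_of_contact {l : List State} {x y : State} (hy : y ∈ l)
    (h : y.s = x.s + x.τ) : ¬ Cons (x.stepB :: x :: l) := fun hB => by
  have hxd := hB.dir x (by simp)
  by_cases hd : x.d = y.d
  · exact (hB.apart_head (List.mem_cons_of_mem _ hy)).left (by simp [h, hd])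
  · obtain ⟨-, -, -, col, hc⟩ := hB
    have h1 := (hc y (by simp [hy])).side x.d hxd hd
    have h2 := (hc y (by simp [hy])).self
    have h3 := (hc x (by simp)).side x.τ (isDir_τ hxd) (d_ne_τ hxd).symm
    have h4 := (hc _ List.mem_cons_self).self
    simp only [stepB_s, stepB_χ] at h4
    rw [h] at h1 h2
    rw [h2] at h3; rw [h1, h3] at h4
    simp at h4

/-- Running straight without a contact ahead, the opposite edge was not taken. -/
theorem oppShare_stepA {l : List State} {i₀ x : State} {L : List State}
    (hL : l ++ [i₀] = x :: L) (h : Cons (x.stepA :: (l ++ [i₀])))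
    (hf : ∀ y ∈ l ++ [i₀], y.s ≠ x.s + x.τ + x.τ) : oppShare x.stepA l = 1 := by
  apply oppShare_eq_one
  intro y hy hys
  simp only [stepA_s, stepA_d] at hys ⊢
  by_contra hne
  have hyL : y ∈ l ++ [i₀] := by simp [hy]
  have hxL : x ∈ l ++ [i₀] := by simp [hL]
  have hxd := h.dir x (by simp [hL])
  have hyd := h.dir y (List.mem_cons_of_mem _ hyL)
  have hap := h.apart_head hyL
  obtain ⟨col, hc⟩ := h.fits
  have fx := hc x (List.mem_cons_of_mem _ hxL)
  have fy := hc y (List.mem_cons_of_mem _ hyL)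
  have fv := hc _ List.mem_cons_self
  have e1 := fv.side (-x.d) hxd.neg (by simpa using hxd.ne_neg.symm)
  have e2 := fv.side x.τ (isDir_τ hxd) (by simpa using (d_ne_τ hxd).symm)
  simp only [stepA_s, stepA_χ] at e1 e2
  have e3 := fy.self
  rw [hys, sub_eq_add_neg, e1] at e3
  -- Along `x.d`, the edge of `y` touches the new blocking vertex; along `-x.d`, the shared edge is
  -- opposite for `y` too; along `-x.τ`, the vertex `x.s - x.d` would have both colours. Only `x.τ`
  -- requires following the contour.
  rcases dir_cases hxd hyd with hd | hd | hd | hd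
  · apply hap.left; simp [hys, hd]
  · apply hne; rw [hys, hd]; abel
  · -- the blocked edge of `y` points ahead
    have hτ : y.τ = x.d ∨ y.τ = -x.d := by
      rcases dir_cases hxd (isDir_τ hyd) with h | h | h | h
      · exact .inl h
      · exact .inr h
      · exact absurd (hd.trans h.symm) (d_ne_τ hyd)
      · exact absurd (by rw [hd, h]; simp) (d_ne_neg_τ hyd)
    -- The contour leaves `y` in direction `x.d` or arrives from that side. The adjacent state there
    -- can only be separated from `y` by a turn, and it then blocks at `x.s + x.τ + x.τ`, which `hf`
    -- excludes.
    rcases hτ with hτ | hτ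
    · obtain ⟨z, hz, hs⟩ := exists_step_to_of_mem h.chain hyL
      have fz := hc z hz
      have e4 : col (y.s + y.τ + y.d) = x.χ := by
        rw [← e2]; congr 1; rw [hτ, hd, hys]; abel
      rcases hs with rfl | rfl | rfl
      · have := fz.out
        simp only [stepA_s, stepA_d, stepA_χ] at this
        rw [e4, e3] at this; simp at this
      · have := fz.self
        simp only [stepB_s, stepB_χ] at this
        rw [e4, e3] at this; simp at this
      · have hzs : y.stepC.s = x.s + x.τ + x.τ := by
          simp only [stepC_s, hτ, hd, hys]; abel
        rcases List.mem_cons.1 hz with hz | hz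
        · have := congrArg State.s hz
          rw [hzs] at this
          simp only [stepA_s, add_eq_left] at this
          exact (isDir_τ hxd).ne_zero this
        · exact hf _ hz hzs
    · obtain ⟨z, hz, hs⟩ := exists_step_of_mem_append h.chain.tail hy
      have hzv := (h.apart_head hz).ne
      have fz := hc z (List.mem_cons_of_mem _ hz)
      have hzd := h.dir z (List.mem_cons_of_mem _ hz)
      rcases hs with rfl | rfl | rfl
      · simp only [stepA_s, stepA_τ] at hys hτ
        apply hzv
        simp only [stepA_s]
        rw [hτ] at hys
        rw [← sub_eq_zero] at hys ⊢
        rw [← neg_eq_zero, ← hys]; abel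
      · simp only [stepB_s, stepB_τ, stepB_d, stepB_χ] at hys hτ hd e3
        have hzs : z.s = x.s + x.τ + x.τ := by
          rw [hτ, ← neg_neg z.d, hd] at hys
          rw [← sub_eq_zero] at hys ⊢
          rw [← hys]; abel
        have := fz.self
        rw [hzs, e2, e3] at this
        simp at this
      · simp only [stepC_s, stepC_τ, stepC_d] at hys hτ hd
        have hzs : z.s = x.s + x.τ + x.τ := by
          rw [hτ, ← neg_neg z.τ, hd] at hys
          rw [← sub_eq_zero] at hys ⊢
          rw [← hys]; abel
        exact hf z hz hzs
  · have e4 := fy.out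
    have e5 := fx.side (-x.d) hxd.neg hxd.ne_neg.symm
    rw [hys, hd] at e4
    rw [show x.s + x.τ - x.d + -x.τ = x.s + -x.d by abel, e5, e3] at e4
    simp at e4

/-- A claimed side of an earlier state ahead of `x` leaves half of the back edge of the next
state. -/
theorem one_le_sideShare_back_stepC {l L : List State} {x y : State} (hl : ∀ y ∈ l, y ∈ L)
    (h : Cons (x.stepC :: x :: L)) (hy : y ∈ l) (hys : y.s = x.s + x.τ)
    (hyd : y.s - y.d ≠ x.s) :
    1 ≤ sideShare x.stepC (x :: l) (x.stepC.s - x.stepC.τ) := by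
  have hxd := h.dir x (by simp)
  -- Along `x.d`, the edge of `y` would end at the vertex after the turn; along `-x.τ`, at `x.s`;
  -- `x.τ` contradicts `hyd`. With `-x.d`, the back edge of the turn is the opposite edge of `y`, of
  -- which only half is taken.
  have hd : y.d = -x.d := by
    rcases dir_cases hxd (h.dir y (by simp [hl y hy])) with hd | hd | hd | hd
    · exfalso
      apply (h.apart_head (y := y) (by simp [hl y hy])).left
      simp only [stepC_s, hys, hd]; abel
    · exact hd
    · exfalso; apply hyd; rw [hys, hd]; abel
    · exfalso
      apply (h.tail.apart_head (y := y) (hl y hy)).left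
      rw [hys, hd]; abel
  apply one_le_sideShare
  intro z hz hzs
  have hzs' : z.s = y.s := by rw [hzs, hys]; simp only [stepC_s, stepC_τ]; abel
  have hzL : z ∈ x :: L := by
    rcases List.mem_cons.1 hz with rfl | hz
    · simp
    · simp [hl z hz]
  have : z = y := h.tail.eq_of_s_eq hzL (by simp [hl y hy]) hzs'
  rw [this, hys, hd]
  simp only [stepC_s]; abel

/-- After three turns the contour has closed up around a single vertex. -/
theorem not_cons_stepC_stepC_stepC {L : List State} {x : State} (hx : x ∈ L) :
    ¬ Cons (x.stepC.stepC.stepC.stepA :: x.stepC.stepC.stepC :: L) ∧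
    ¬ Cons (x.stepC.stepC.stepC.stepB :: x.stepC.stepC.stepC :: L) ∧
    ¬ Cons (x.stepC.stepC.stepC.stepC :: x.stepC.stepC.stepC :: L) := by
  refine ⟨fun h => ?_, fun h => ?_, fun h => ?_⟩
  · obtain ⟨-, -, -, col, hc⟩ := h
    have h1 := (hc x (by simp [hx])).self
    have h2 := (hc _ List.mem_cons_self).out
    simp only [stepA_s, stepA_d, stepA_χ, stepC_s, stepC_d, stepC_χ, stepC_τ] at h2
    rw [show x.s + x.d + x.τ + -x.τ + x.d + -x.d + -x.τ + -x.d + - -x.τ = x.s by abel, h1] at h2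
    simp at h2
  · obtain ⟨-, -, -, col, hc⟩ := h
    have h1 := (hc x (by simp [hx])).self
    have h2 := (hc _ List.mem_cons_self).self
    simp only [stepB_s, stepB_χ, stepC_s, stepC_d, stepC_χ, stepC_τ] at h2
    rw [show x.s + x.d + x.τ + -x.τ + x.d + -x.d + -x.τ + -x.d + - -x.τ = x.s by abel, h1] at h2
    simp at h2
  · apply (h.apart_head (y := x) (by simp [hx])).ne
    simp only [stepC_s, stepC_d, stepC_τ]
    abel

end State

/-! ### Exponential decay of the total weight of contours. -/

namespace State

open Classical in
/-- The contribution of the continuation `x` of `l ++ [i₀]`, if `f` is the total weight of the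
further continuations. -/
noncomputable def contourTerm (i₀ : State) (f : List State → ℝ) (l : List State) (x : State) : ℝ :=
  if Cons (x :: (l ++ [i₀])) then weight x l * f (x :: l) else 0

/-- The total weight of all continuations by `m` states of the piece of contour `l ++ [i₀]`. -/
noncomputable def contourSum (i₀ : State) : ℕ → List State → ℝ
  | 0, _ => 1
  | m + 1, l => contourTerm i₀ (contourSum i₀ m) l (l.headD i₀).stepA +
      contourTerm i₀ (contourSum i₀ m) l (l.headD i₀).stepB +
      contourTerm i₀ (contourSum i₀ m) l (l.headD i₀).stepC

theorem contourTerm_of_cons {i₀ x : State} {f : List State → ℝ} {l : List State}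
    (h : Cons (x :: (l ++ [i₀]))) : contourTerm i₀ f l x = weight x l * f (x :: l) := if_pos h

theorem contourTerm_of_not_cons {i₀ x : State} {f : List State → ℝ} {l : List State}
    (h : ¬ Cons (x :: (l ++ [i₀]))) : contourTerm i₀ f l x = 0 := if_neg h

theorem contourTerm_le {i₀ x : State} {f : List State → ℝ} {l : List State} {b : ℝ} (hb : 0 ≤ b)
    (h : Cons (x :: (l ++ [i₀])) → weight x l * f (x :: l) ≤ b) : contourTerm i₀ f l x ≤ b := by
  unfold contourTerm
  split_ifs with hx
  exacts [h hx, hb]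

theorem contourSum_nonneg (i₀ : State) (m : ℕ) (l : List State) : 0 ≤ contourSum i₀ m l := by
  induction m generalizing l with
  | zero => simp [contourSum]
  | succ m ih =>
    have key : ∀ x : State, 0 ≤ contourTerm i₀ (contourSum i₀ m) l x := by
      intro x
      unfold contourTerm
      split_ifs
      exacts [mul_nonneg (weight_pos _ _).le (ih _), le_rfl]
    rw [contourSum]
    exact add_nonneg (add_nonneg (key _) (key _)) (key _)

theorem append_eq_headD_cons (l : List State) (i₀ : State) :
    l ++ [i₀] = l.headD i₀ :: (l ++ [i₀]).tail := by
  cases l <;> simp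

theorem headD_mem (l : List State) (i₀ : State) : l.headD i₀ ∈ l ++ [i₀] := by
  rw [append_eq_headD_cons]; simp

theorem weight_mul_contourSum_le {i₀ : State} {m : ℕ} {l l' : List State} {x : State} {w b : ℝ}
    (hw : weight x l' ≤ w) (hb : contourSum i₀ m l ≤ b) :
    weight x l' * contourSum i₀ m l ≤ w * b :=
  mul_le_mul hw hb (contourSum_nonneg _ _ _) ((weight_pos _ _).le.trans hw)

theorem contourSum_le_three_pow (i₀ : State) (m : ℕ) (l : List State) :
    contourSum i₀ m l ≤ 3 ^ m := by
  induction m generalizing l with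
  | zero => simp [contourSum]
  | succ m ih =>
    have key : ∀ x : State, contourTerm i₀ (contourSum i₀ m) l x ≤ 3 ^ m := fun x =>
      contourTerm_le (by positivity) fun _ => by
        simpa using weight_mul_contourSum_le (weight_le_one x l) (ih (x :: l))
    rw [contourSum, pow_succ]
    linarith [key (l.headD i₀).stepA, key (l.headD i₀).stepB, key (l.headD i₀).stepC]

/-- If the contour is forced to turn, only one continuation is left. -/
theorem contourSum_le_of_forced {i₀ : State} {m : ℕ} {l : List State} {b : ℝ} (hb : 0 ≤ b)
    (hA : ¬ Cons ((l.headD i₀).stepA :: (l ++ [i₀])))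
    (hB : ¬ Cons ((l.headD i₀).stepB :: (l ++ [i₀])))
    (h : Cons ((l.headD i₀).stepC :: (l ++ [i₀])) →
      weight (l.headD i₀).stepC l * contourSum i₀ m ((l.headD i₀).stepC :: l) ≤ b) :
    contourSum i₀ (m + 1) l ≤ b := by
  rw [contourSum, contourTerm_of_not_cons hA, contourTerm_of_not_cons hB, zero_add, zero_add]
  exact contourTerm_le hb h

theorem contourSum_le_of_contact {i₀ v : State} {m : ℕ} {l : List State} {b : ℝ} (hb : 0 ≤ b)
    (hv : ∃ y ∈ l ++ [i₀], y.s = v.s + v.τ)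
    (h : Cons (v.stepC :: v :: (l ++ [i₀])) →
      weight v.stepC (v :: l) * contourSum i₀ m (v.stepC :: v :: l) ≤ b) :
    contourSum i₀ (m + 1) (v :: l) ≤ b := by
  obtain ⟨y, hy, hys⟩ := hv
  exact contourSum_le_of_forced hb (not_cons_stepA_of_contact hy hys)
    (not_cons_stepB_of_contact hy hys) h

theorem weight_le_half {v : State} {l : List State} (h : ∀ y ∈ l, y.s ≠ v.s + v.τ) :
    weight v l ≤ 1 / 2 := by
  have : 2 ≤ shares v l := by
    rw [shares, sideShare_eq_two h]; omega
  exact (weight_le this).trans (by norm_num)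

theorem contourSum_forced_le {i₀ : State} {m : ℕ} {l : List State} {b : ℝ} (hb₀ : 0 ≤ b)
    (hb₂ : ∀ l, Cons (l ++ [i₀]) → contourSum i₀ (m + 2) l ≤ b)
    (hb₃ : ∀ l, Cons (l ++ [i₀]) → contourSum i₀ (m + 3) l ≤ b)
    (hA : ¬ Cons ((l.headD i₀).stepA :: (l ++ [i₀])))
    (hB : ¬ Cons ((l.headD i₀).stepB :: (l ++ [i₀]))) :
    contourSum i₀ (m + 4) l ≤ 1 / 2 * b := by
  set x := l.headD i₀ with hx
  have hxl : x ∈ l ++ [i₀] := headD_mem l i₀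
  refine contourSum_le_of_forced (by positivity) hA hB fun h₁ => ?_
  by_cases c₁ : ∃ y ∈ l, y.s = x.stepC.s + x.stepC.τ
  swap
  · push Not at c₁
    exact weight_mul_contourSum_le (weight_le_half c₁) (hb₃ _ h₁)
  rw [← one_mul (1 / 2 * b)]
  refine weight_mul_contourSum_le (weight_le_one _ _) ?_
  obtain ⟨y, hy, hys⟩ := c₁
  refine contourSum_le_of_contact (by positivity) ⟨y, by simp [hy], hys⟩ fun h₂ => ?_
  by_cases c₂ : ∃ y ∈ x.stepC :: l, y.s = x.stepC.stepC.s + x.stepC.stepC.τ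
  swap
  · push Not at c₂
    exact weight_mul_contourSum_le (weight_le_half c₂) (hb₂ _ h₂)
  rw [← one_mul (1 / 2 * b)]
  refine weight_mul_contourSum_le (weight_le_one _ _) ?_
  obtain ⟨y, hy, hys⟩ := c₂
  refine contourSum_le_of_contact (by positivity)
    ⟨y, by rcases List.mem_cons.1 hy with h | h <;> simp [h, x], hys⟩ fun h₃ => ?_
  have hdead := not_cons_stepC_stepC_stepC (x := x)
    (L := x.stepC.stepC :: x.stepC :: (l ++ [i₀])) (by simp only [List.mem_cons, hxl, or_true])
  have h0 : contourSum i₀ (m + 1) (x.stepC.stepC.stepC :: x.stepC.stepC :: x.stepC :: l) = 0 := by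
    rw [contourSum, contourTerm_of_not_cons hdead.1, contourTerm_of_not_cons hdead.2.1,
      contourTerm_of_not_cons hdead.2.2]
    simp
  rw [h0]; simpa using hb₀

/-- The edge behind the new vertex is normally claimed by the previous state, so the opposite edge
and the edge ahead must suffice. If the latter is free they give 1 + 2 halves, hence 2/5. A contact
ahead forces a turn, which makes up for the larger weight. -/
theorem weight_stepA_mul_le {i₀ : State} {m : ℕ} {l : List State} {b : ℝ} (hb₀ : 0 ≤ b)
    (hb₂ : ∀ l, Cons (l ++ [i₀]) → contourSum i₀ (m + 2) l ≤ b)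
    (hb₃ : ∀ l, Cons (l ++ [i₀]) → contourSum i₀ (m + 3) l ≤ b)
    (hb₄ : ∀ l, Cons (l ++ [i₀]) → contourSum i₀ (m + 4) l ≤ b)
    (hb₅ : ∀ l, Cons (l ++ [i₀]) → contourSum i₀ (m + 5) l ≤ b)
    (h : Cons ((l.headD i₀).stepA :: (l ++ [i₀]))) :
    weight (l.headD i₀).stepA l * contourSum i₀ (m + 5) ((l.headD i₀).stepA :: l) ≤
      2 / 5 * b := by
  set x := l.headD i₀ with hx
  by_cases c : ∃ y ∈ l ++ [i₀], y.s = x.stepA.s + x.stepA.τ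
  swap
  · push Not at c
    have : 3 ≤ shares x.stepA l := by
      rw [shares, sideShare_eq_two (fun y hy => c y (by simp [hy])),
        oppShare_stepA (append_eq_headD_cons l i₀) h c]
      omega
    refine weight_mul_contourSum_le ((weight_le this).trans (by norm_num)) (hb₅ _ h)
  obtain ⟨y, hy, hys⟩ := c
  -- If no state of `l` holds the edge ahead as a side edge, at least half of it is left, and the
  -- weight 2/3 is followed by the forced factor 1/2.
  by_cases c₁ : ∃ y ∈ l, y.s = x.stepA.s + x.stepA.τ ∧ y.s - y.d ≠ x.stepA.s
  swap
  · push Not at c₁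
    have : 1 ≤ shares x.stepA l := by
      have := one_le_sideShare c₁
      rw [shares]; omega
    refine (weight_mul_contourSum_le ((weight_le this).trans (by norm_num : _ ≤ (2 / 3 : ℝ)))
      (contourSum_forced_le (m := m + 1) (l := x.stepA :: l) hb₀ hb₃ hb₄ (not_cons_stepA_of_contact hy hys)
        (not_cons_stepB_of_contact hy hys))).trans ?_
    linarith
  rw [← one_mul (2 / 5 * b)]
  refine weight_mul_contourSum_le (weight_le_one _ _) ?_
  obtain ⟨z, hz, hzs, hzd⟩ := c₁
  refine contourSum_le_of_contact (by positivity) ⟨y, hy, hys⟩ fun h₂ => ?_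
  -- Now the straight step may have weight 1, but the turn after it has half of its back edge: it
  -- costs 2/5 if its way ahead is free, otherwise 2/3 with another forced factor 1/2.
  have hback := one_le_sideShare_back_stepC (l := l) (fun y hy => by simp [hy]) h₂ hz hzs hzd
  by_cases c₂ : ∃ y ∈ x.stepA :: l, y.s = x.stepA.stepC.s + x.stepA.stepC.τ
  swap
  · push Not at c₂
    have : 3 ≤ shares x.stepA.stepC (x.stepA :: l) := by
      rw [shares, sideShare_eq_two c₂]; omega
    exact weight_mul_contourSum_le ((weight_le this).trans (by norm_num)) (hb₄ _ h₂)
  obtain ⟨w, hw, hws⟩ := c₂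
  have hw' : w ∈ x.stepA :: (l ++ [i₀]) := by
    rcases List.mem_cons.1 hw with h | h <;> simp [h]
  have : 1 ≤ shares x.stepA.stepC (x.stepA :: l) := by rw [shares]; omega
  refine (weight_mul_contourSum_le ((weight_le this).trans (by norm_num : _ ≤ (2 / 3 : ℝ)))
    (contourSum_forced_le (m := m) (l := x.stepA.stepC :: x.stepA :: l) hb₀ hb₂ hb₃ (not_cons_stepA_of_contact hw' hws)
      (not_cons_stepB_of_contact hw' hws))).trans ?_
  linarith

/-- The vertex behind the new one is `x.s + x.d`, the far end of the contour edge of `x`. By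
separation no state blocks there, so that side edge is free. -/
theorem weight_stepB_le_half {i₀ : State} {l : List State} (h : Cons (l ++ [i₀])) :
    weight (l.headD i₀).stepB l ≤ 1 / 2 := by
  set x := l.headD i₀ with hx
  have hxl : x ∈ l ++ [i₀] := headD_mem l i₀
  have : 2 ≤ shares x.stepB l := by
    rw [shares, sideShare_eq_two (z := x.stepB.s - x.stepB.τ)]
    · omega
    · intro y hy hys
      have hys' : y.s = x.s + x.d := by
        rw [hys]; simp only [stepB_s, stepB_τ]; abel
      rw [append_eq_headD_cons, ← hx] at h
      have hy' : y ∈ l ++ [i₀] := by simp [hy]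
      rw [append_eq_headD_cons, ← hx] at hy'
      rcases List.mem_cons.1 hy' with rfl | hy'
      · exact (h.dir x (by simp)).ne_zero (by simpa using hys'.symm)
      · exact (h.apart_head hy').right hys'
  exact (weight_le this).trans (by norm_num)

theorem weight_le_of_isolated {x : State} {l : List State} (hd : IsDir x.d)
    (h : ∀ y ∈ l, ∀ v, IsDir v → y.s ≠ x.s + v) : weight x l ≤ 2 / 7 := by
  have hτ := isDir_τ hd
  have : 5 ≤ shares x l := by
    rw [shares, sideShare_eq_two, sideShare_eq_two, oppShare_eq_one]
    · intro y hy hys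
      exact absurd (by rw [hys]; abel) (h y hy _ hd.neg)
    · intro y hy hys
      exact absurd (by rw [hys]; abel) (h y hy _ hτ.neg)
    · intro y hy hys
      exact absurd (by rw [hys]) (h y hy _ hτ)
  exact (weight_le this).trans (by norm_num)

/-- If the next vertex may have either colour, B and C both block at it, and by `ne_of_ambiguous` it
has no blocking neighbour: weight 2/7 each, beside 2/5 for A. Otherwise C is impossible and A, B
cost 2/5 and 1/2, or the turn is forced and costs 1/2 of `b`; `b ≤ 2 * b'` fits the last case into
the same bound. -/
theorem contourSum_step {i₀ : State} {m : ℕ} {l : List State} {b b' : ℝ} (hb₀ : 0 ≤ b)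
    (hbb : b' ≤ b) (hbb' : b ≤ 2 * b')
    (hb₂ : ∀ l, Cons (l ++ [i₀]) → contourSum i₀ (m + 2) l ≤ b)
    (hb₃ : ∀ l, Cons (l ++ [i₀]) → contourSum i₀ (m + 3) l ≤ b)
    (hb₄ : ∀ l, Cons (l ++ [i₀]) → contourSum i₀ (m + 4) l ≤ b)
    (hb₅ : ∀ l, Cons (l ++ [i₀]) → contourSum i₀ (m + 5) l ≤ b')
    (h : Cons (l ++ [i₀])) :
    contourSum i₀ (m + 6) l ≤ 2 / 5 * b + 4 / 7 * b' := by
  set x := l.headD i₀ with hx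
  have hb₀' : 0 ≤ b' := by linarith
  have hTA : contourTerm i₀ (contourSum i₀ (m + 5)) l x.stepA ≤ 2 / 5 * b :=
    contourTerm_le (by positivity)
      (weight_stepA_mul_le hb₀ hb₂ hb₃ hb₄ fun l hl => (hb₅ l hl).trans hbb)
  by_cases hC : Cons (x.stepC :: (l ++ [i₀]))
  swap
  · rw [contourSum, ← hx, contourTerm_of_not_cons hC, add_zero]
    refine (add_le_add hTA (?_ : _ ≤ 1 / 2 * b')).trans (by linarith)
    exact contourTerm_le (by positivity) fun hB =>
      weight_mul_contourSum_le (weight_stepB_le_half h) (hb₅ _ hB)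
  by_cases hAB : Cons (x.stepA :: (l ++ [i₀])) ∨ Cons (x.stepB :: (l ++ [i₀]))
  swap
  · rw [not_or] at hAB
    have := contourSum_forced_le (m := m + 2) hb₀ hb₄ (fun l hl => (hb₅ l hl).trans hbb)
      hAB.1 hAB.2
    linarith
  have hiso : ∀ y ∈ l, ∀ v, IsDir v → y.s ≠ x.s + x.d + x.τ + v := fun y hy v hv =>
    ne_of_ambiguous hC hAB (by simp [hy]) hv
  have hTB : contourTerm i₀ (contourSum i₀ (m + 5)) l x.stepB ≤ 2 / 7 * b' := by
    refine contourTerm_le (by positivity) fun hB => ?_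
    refine weight_mul_contourSum_le (weight_le_of_isolated (hB.dir _ (by simp))
      fun y hy v hv => ?_) (hb₅ _ hB)
    rw [stepB_s, show x.s + x.τ + x.d = x.s + x.d + x.τ by abel]
    exact hiso y hy v hv
  have hTC : contourTerm i₀ (contourSum i₀ (m + 5)) l x.stepC ≤ 2 / 7 * b' :=
    contourTerm_le (by positivity) fun _ => 
      weight_mul_contourSum_le (weight_le_of_isolated (hC.dir _ (by simp)) hiso) (hb₅ _ hC)
  rw [contourSum, ← hx]
  linarith

/-- The total weight of the contours of length `m` decays exponentially. -/
theorem contourSum_le {i₀ : State} (m : ℕ) {l : List State} (h : Cons (l ++ [i₀])) :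
    contourSum i₀ m l ≤ 1000 * (99 / 100 : ℝ) ^ m := by
  induction m using Nat.strong_induction_on generalizing l with
  | _ m ih =>
    by_cases hm : m < 6
    · refine (contourSum_le_three_pow i₀ m l).trans ?_
      -- The prefactor 1000 leaves room for 3⁵ = 243.
      interval_cases m <;> norm_num
    · obtain ⟨k, rfl⟩ : ∃ k, m = k + 6 := ⟨m - 6, by omega⟩
      have hp : (0 : ℝ) < (99 / 100) ^ k := by positivity
      have hb : ∀ j, 2 ≤ j → j < 6 → ∀ l, Cons (l ++ [i₀]) →
          contourSum i₀ (k + j) l ≤ 1000 * (99 / 100 : ℝ) ^ (k + 2) := fun j hj hj' l hl =>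
        (ih (k + j) (by omega) hl).trans (mul_le_mul_of_nonneg_left
          (pow_le_pow_of_le_one (by norm_num) (by norm_num) (by omega)) (by norm_num))
      refine (contourSum_step (b := 1000 * (99 / 100 : ℝ) ^ (k + 2))
        (b' := 1000 * (99 / 100 : ℝ) ^ (k + 5)) (by positivity) ?_ ?_ (hb 2 le_rfl (by norm_num))
        (hb 3 (by norm_num) (by norm_num)) (hb 4 (by norm_num) (by norm_num))
        (fun l hl => ih (k + 5) (by omega) hl) h).trans ?_
      -- The main inequality amounts to 2/5 + 4/7 · 0.99³ ≤ 0.99⁴, where b' = 0.99³ b.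
      all_goals
        simp only [pow_add]
        nlinarith

end State

/-! ### Clock estimates by sharing square roots. -/

/-- Independent clocks, uniform on `[0,1]`. -/
noncomputable abbrev clockMeasure (ι : Type*) : Measure (ι → unitInterval) :=
  Measure.infinitePi fun _ : ι => (volume : Measure unitInterval)

/-- The square root as a map from `[0,1]` to `[0,∞]`. -/
noncomputable def sqrtClock (u : unitInterval) : ENNReal := ENNReal.ofReal (Real.sqrt u)

theorem measurable_sqrtClock : Measurable sqrtClock :=
  (Real.continuous_sqrt.measurable.comp measurable_subtype_coe).ennreal_ofReal

theorem sqrtClock_sq (u : unitInterval) : sqrtClock u ^ 2 = ENNReal.ofReal u := by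
  rw [sqrtClock, ← ENNReal.ofReal_pow (Real.sqrt_nonneg _), Real.sq_sqrt u.2.1]

theorem sqrtClock_le_one (u : unitInterval) : sqrtClock u ≤ 1 := by
  rw [sqrtClock, ENNReal.ofReal_le_one, Real.sqrt_le_one]; exact u.2.2

theorem sqrtClock_mono {u v : unitInterval} (h : u ≤ v) : sqrtClock u ≤ sqrtClock v :=
  ENNReal.ofReal_le_ofReal (Real.sqrt_le_sqrt h)

theorem lintegral_sqrtClock_pow (k : ℕ) :
    ∫⁻ u, sqrtClock u ^ k = ENNReal.ofReal (2 / (2 + k)) := by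
  have h1 : ∀ u : unitInterval, sqrtClock u ^ k = ENNReal.ofReal ((u : ℝ) ^ ((k : ℝ) / 2)) := by
    intro u
    rw [sqrtClock, ← ENNReal.ofReal_pow (Real.sqrt_nonneg _), Real.sqrt_eq_rpow,
      ← Real.rpow_mul_natCast u.2.1]
    congr 2; ring
  simp_rw [h1]
  have h2 := unitInterval.measurePreserving_coe.lintegral_comp_emb
    unitInterval.measurableEmbedding_coe
    (fun x : ℝ => ENNReal.ofReal (x ^ ((k : ℝ) / 2)))
  rw [h2, ← ofReal_integral_eq_lintegral_ofReal]
  · rw [integral_Icc_eq_integral_Ioc, ← intervalIntegral.integral_of_le zero_le_one,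
      integral_rpow (.inl (by linarith [(Nat.cast_nonneg k : (0 : ℝ) ≤ k)]))]
    congr 1
    have : (k : ℝ) / 2 + 1 ≠ 0 := by positivity
    rw [Real.one_rpow, Real.zero_rpow this]
    field_simp
    ring
  · have : IntervalIntegrable (fun x : ℝ => x ^ ((k : ℝ) / 2)) volume 0 1 :=
      intervalIntegral.intervalIntegrable_rpow' (by linarith [(Nat.cast_nonneg k : (0 : ℝ) ≤ k)])
    exact (intervalIntegrable_iff_integrableOn_Icc_of_le zero_le_one).1 this
  · exact (ae_restrict_iff' measurableSet_Icc).2 (.of_forall fun x hx =>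
      Real.rpow_nonneg hx.1 _)

/-- The volume of the clock values that are below all `a i` is at most a product of powers of
the `√(a i)` with total exponent two. -/
theorem volume_lt_all_le {ι : Type*} {I : Finset ι} {p : ι → Prop} {a : ι → unitInterval}
    {c : ι → ℕ} (hc : ∀ i ∈ I, c i ≠ 0 → p i) (hsum : ∑ i ∈ I, c i ≤ 2) :
    (volume : Measure unitInterval) {y | ∀ i ∈ I, p i → y < a i} ≤
      ∏ i ∈ I, sqrtClock (a i) ^ c i := by
  by_cases h0 : ∃ i ∈ I, c i ≠ 0
  · obtain ⟨i₁, hi₁, hmin⟩ := (I.filter fun i => c i ≠ 0).exists_min_image a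
      (by obtain ⟨i, hi, h⟩ := h0; exact ⟨i, by simp [hi, h]⟩)
    rw [Finset.mem_filter] at hi₁
    calc (volume : Measure unitInterval) {y | ∀ i ∈ I, p i → y < a i}
        ≤ volume (Set.Iio (a i₁)) := measure_mono fun y hy => hy i₁ hi₁.1 (hc i₁ hi₁.1 hi₁.2)
      _ = sqrtClock (a i₁) ^ 2 := by rw [unitInterval.volume_Iio, sqrtClock_sq]
      _ ≤ sqrtClock (a i₁) ^ ∑ i ∈ I, c i := pow_le_pow_of_le_one zero_le (sqrtClock_le_one _) hsum
      _ = ∏ i ∈ I, sqrtClock (a i₁) ^ c i := (Finset.prod_pow_eq_pow_sum _ _ _).symm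
      _ ≤ ∏ i ∈ I, sqrtClock (a i) ^ c i := by
        refine Finset.prod_le_prod' fun i hi => ?_
        by_cases h : c i = 0
        · simp [h]
        · exact pow_le_pow_left' (sqrtClock_mono (hmin i (by simp [hi, h]))) _
  · push Not at h0
    rw [Finset.prod_eq_one fun i hi => by simp [h0 i hi]]
    exact prob_le_one

/-- If the clocks in `I` have to beat certain clocks in `J`, each clock `j ∈ J` may be shared out
among the clocks it has to lose against. -/
theorem clockMeasure_lt_le {ι : Type*} {I J : Finset ι} (hIJ : Disjoint I J) {r : ι → ι → Prop}
    {c : ι → ι → ℕ} (hc : ∀ i ∈ I, ∀ j ∈ J, c i j ≠ 0 → r i j)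
    (hsum : ∀ j ∈ J, ∑ i ∈ I, c i j ≤ 2) :
    clockMeasure ι {U | ∀ j ∈ J, ∀ i ∈ I, r i j → U j < U i} ≤
      ∏ i ∈ I, ENNReal.ofReal (2 / (2 + (∑ j ∈ J, c i j : ℕ))) := by
  classical
  have hind : ProbabilityTheory.iIndepFun (fun i (U : ι → unitInterval) => U i)
      (clockMeasure ι) :=
    ProbabilityTheory.iIndepFun_infinitePi (X := fun _ u => u) fun _ => measurable_id
  have hind' := hind.indepFun_finset I J hIJ (fun i => measurable_pi_apply i)
  have hprod := hind'.map_prod_eq_prod_map_map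
    (measurable_pi_lambda _ fun i => measurable_pi_apply _).aemeasurable
    (measurable_pi_lambda _ fun i => measurable_pi_apply _).aemeasurable
  set S : Set ((I → unitInterval) × (J → unitInterval)) :=
    {q | ∀ j : J, ∀ i : I, r i j → q.2 j < q.1 i} with hS
  have hSm : MeasurableSet S := by
    simp only [hS, Set.ofPred_forall]
    refine MeasurableSet.iInter fun j => .iInter fun i => .iInter fun _ => ?_
    exact measurableSet_lt ((measurable_pi_apply _).comp measurable_snd)
      ((measurable_pi_apply _).comp measurable_fst)
  have hE : {U : ι → unitInterval | ∀ j ∈ J, ∀ i ∈ I, r i j → U j < U i} =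
      (fun U => ((fun i : I => U i), fun j : J => U j)) ⁻¹' S := by
    ext U; simp [hS]
  rw [hE, ← Measure.map_apply (by fun_prop) hSm, hprod, Measure.prod_apply hSm,
    lintegral_map (measurable_measure_prodMk_left hSm) (by fun_prop)]
  have hJ : (clockMeasure ι).map (fun U (j : J) => U j) =
      Measure.pi fun _ : J => (volume : Measure unitInterval) :=
    Measure.infinitePi_map_restrict _
  rw [hJ]
  -- For fixed clocks in `I`, those in `J` are independent and the fibre is a product set.
  -- Exchanging the products collects the total exponent of each clock in `I`.
  calc ∫⁻ U, (Measure.pi fun _ : J => (volume : Measure unitInterval))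
          (Prod.mk (fun i : I => U i) ⁻¹' S) ∂clockMeasure ι
      ≤ ∫⁻ U, ∏ i ∈ I, sqrtClock (U i) ^ (∑ j ∈ J, c i j) ∂clockMeasure ι := by
        refine lintegral_mono fun U => ?_
        have : Prod.mk (fun i : I => U i) ⁻¹' S =
            Set.pi Set.univ fun j : J => {y : unitInterval | ∀ i ∈ I, r i j → y < U i} := by
          ext b; simp [hS]
        simp only
        rw [this, Measure.pi_pi]
        calc ∏ j : J, (volume : Measure unitInterval) {y | ∀ i ∈ I, r i j → y < U i}
            ≤ ∏ j : J, ∏ i ∈ I, sqrtClock (U i) ^ c i j := Finset.prod_le_prod' fun j _ =>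
              volume_lt_all_le (fun i hi h => hc i hi j j.2 h) (hsum j j.2)
          _ = ∏ i ∈ I, sqrtClock (U i) ^ (∑ j ∈ J, c i j) := by
            rw [Finset.prod_comm]
            refine Finset.prod_congr rfl fun i _ => ?_
            rw [Finset.prod_pow_eq_pow_sum, Finset.sum_coe_sort J fun j => c i j]
    _ = ∏ i ∈ I, ∫⁻ U, sqrtClock (U i) ^ (∑ j ∈ J, c i j) ∂clockMeasure ι := by
        refine ProbabilityTheory.lintegral_prod_eq_prod_lintegral_of_indepFun I
          (fun i (U : ι → unitInterval) => sqrtClock (U i) ^ (∑ j ∈ J, c i j)) ?_ ?_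
        · exact hind.comp (fun i u => sqrtClock u ^ (∑ j ∈ J, c i j))
            fun i => measurable_sqrtClock.pow_const _
        · exact fun i => (measurable_sqrtClock.comp (measurable_pi_apply i)).pow_const _
    _ = _ := by
        refine Finset.prod_congr rfl fun i _ => ?_
        rw [← lintegral_sqrtClock_pow]
        exact (measurePreserving_eval_infinitePi
          (fun _ : ι => (volume : Measure unitInterval)) i).lintegral_comp
          (measurable_sqrtClock.pow_const _)

/-! ### Edges given by a vertex and a direction. -/

theorem adj_add_iff {v δ : ℤ × ℤ} : lattice.Adj v (v + δ) ↔ IsDir δ := by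
  simp [lattice, IsDir]

open Classical in
/-- The edge from `v` to `v + δ` (for a unit vector `δ`). -/
noncomputable def edgeAt (v δ : ℤ × ℤ) : Edge :=
  if h : IsDir δ then ⟨s(v, v + δ), (SimpleGraph.mem_edgeSet _).2 (adj_add_iff.2 h)⟩
  else ⟨s(v, v + (1, 0)), (SimpleGraph.mem_edgeSet _).2 (adj_add_iff.2 (by simp [IsDir]))⟩

theorem edgeAt_val {v δ : ℤ × ℤ} (h : IsDir δ) : (edgeAt v δ).1 = s(v, v + δ) := by
  rw [edgeAt, dif_pos h]

theorem edgeAt_eq_iff {v w δ ε : ℤ × ℤ} (hδ : IsDir δ) (hε : IsDir ε) :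
    edgeAt v δ = edgeAt w ε ↔ (v = w ∧ δ = ε) ∨ (w = v + δ ∧ ε = -δ) := by
  rw [← Subtype.val_inj, edgeAt_val hδ, edgeAt_val hε, Sym2.eq_iff]
  constructor
  · rintro (⟨rfl, h⟩ | ⟨h, rfl⟩)
    · exact .inl ⟨rfl, by simpa using h⟩
    · refine .inr ⟨rfl, ?_⟩
      rw [add_assoc, left_eq_add] at h
      exact (neg_eq_of_add_eq_zero_right h).symm
  · rintro (⟨rfl, rfl⟩ | ⟨rfl, rfl⟩) <;> simp

theorem exists_edgeAt (e : Edge) {v : ℤ × ℤ} (hv : v ∈ e.1) : ∃ δ, IsDir δ ∧ e = edgeAt v δ := by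
  obtain ⟨w, hw⟩ := Sym2.mem_iff_exists.1 hv
  have hadj : lattice.Adj v w := by
    have := e.2; rw [hw] at this; exact this
  refine ⟨w - v, ?_, ?_⟩
  · rw [← adj_add_iff (v := v)]; simpa using hadj
  · have : IsDir (w - v) := by rw [← adj_add_iff (v := v)]; simpa using hadj
    rw [← Subtype.val_inj, edgeAt_val this, hw]; simp

/-! ### Probability of a blocked piece of contour. -/

namespace State

/-- The edge of a state. -/
noncomputable def edge (x : State) : Edge := edgeAt x.s x.d

/-- The clock of the edge of `x` is the last one to ring among the edges at `x.s`. -/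
def Blocks (U : Clocks) (x : State) : Prop :=
  ∀ δ, IsDir δ → δ ≠ x.d → U (edgeAt x.s δ) < U x.edge

/-- The directions at `x.s` other than `x.d`. -/
def others (x : State) : Finset (ℤ × ℤ) := {-x.d, x.τ, -x.τ}

theorem isDir_of_mem_others {x : State} (h : IsDir x.d) {δ : ℤ × ℤ} (hδ : δ ∈ x.others) :
    IsDir δ := by
  simp only [others, Finset.mem_insert, Finset.mem_singleton] at hδ
  rcases hδ with rfl | rfl | rfl
  exacts [h.neg, isDir_τ h, (isDir_τ h).neg]

theorem ne_of_mem_others {x : State} (h : IsDir x.d) {δ : ℤ × ℤ} (hδ : δ ∈ x.others) :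
    δ ≠ x.d := by
  simp only [others, Finset.mem_insert, Finset.mem_singleton] at hδ
  rcases hδ with rfl | rfl | rfl
  exacts [h.ne_neg.symm, (d_ne_τ h).symm, (d_ne_neg_τ h).symm]

theorem sum_others {x : State} (h : IsDir x.d) (f : ℤ × ℤ → ℕ) :
    ∑ δ ∈ x.others, f δ = f (-x.d) + f x.τ + f (-x.τ) := by
  rw [others, Finset.sum_insert, Finset.sum_pair, add_assoc]
  · exact (isDir_τ h).ne_neg
  · simp only [Finset.mem_insert, Finset.mem_singleton, not_or, neg_inj]
    exact ⟨fun h' => d_ne_neg_τ h (by rw [← h', neg_neg]), d_ne_τ h⟩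

/-- The product of the weights of the states of `l`. -/
noncomputable def weightProd : List State → ℝ
  | [] => 1
  | x :: l => weight x l * weightProd l

theorem weightProd_nonneg (l : List State) : 0 ≤ weightProd l := by
  induction l with
  | nil => simp [weightProd]
  | cons x l ih => exact mul_nonneg (weight_pos _ _).le ih

/-- The edges can be shared out so that every state gets its shares. -/
theorem exists_shares {l : List State} (hd : ∀ x ∈ l, IsDir x.d) (hl : l.Pairwise Apart) :
    ∃ c : State → ℤ × ℤ → ℕ,
      (∀ x ∈ l, ∀ δ, c x δ ≤ 2) ∧ (∀ x ∈ l, c x (-x.d) ≤ 1) ∧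
      (∀ x ∈ l, ∀ y ∈ l, x.s ≠ y.s → ∀ δ, IsDir δ → y.s = x.s + δ → c x δ + c y (-δ) ≤ 2) ∧
      weightProd l = (l.map fun x => 2 / (2 + ((∑ δ ∈ x.others, c x δ : ℕ) : ℝ))).prod := by
  classical
  induction l with
  | nil => exact ⟨fun _ _ => 0, by simp [weightProd]⟩
  | cons x l ih =>
    obtain ⟨c, h2, h1, hp, hw⟩ := ih (fun y hy => hd y (by simp [hy])) hl.of_cons
    have hap : ∀ y ∈ l, Apart x y := (List.pairwise_cons.1 hl).1
    have hxl : ∀ y ∈ l, y ≠ x := fun y hy h => (hap y hy).ne (by rw [h])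
    have hxd := hd x (by simp)
    set new : ℤ × ℤ → ℕ := fun δ =>
      if δ = -x.d then oppShare x l else if δ = x.d then 0 else sideShare x l (x.s + δ) with hnew
    have hopp : oppShare x l ≤ 1 := by unfold oppShare; split_ifs <;> simp
    have hside : ∀ z, sideShare x l z ≤ 2 := by
      intro z; unfold sideShare; split_ifs <;> simp
    have hnew2 : ∀ δ, new δ ≤ 2 := by
      intro δ; simp only [hnew]; split_ifs
      exacts [hopp.trans (by norm_num), by norm_num, hside _]
    -- If the edge is opposite for `y`, then `y` holds at most one half and the new state takes at
    -- most the other. Otherwise `y` may hold both halves and the new state gets none.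
    have hcross : ∀ y ∈ l, ∀ δ, y.s = x.s + δ → new δ + c y (-δ) ≤ 2 := by
      intro y hy δ hys
      by_cases hyd : y.s - y.d = x.s
      · have hδ : -δ = -y.d := by
          rw [← hyd] at hys
          rw [neg_inj]
          calc δ = (y.s - y.d + δ) - (y.s - y.d) := by abel
            _ = y.d := by rw [← hys]; abel
        have hc : c y (-δ) ≤ 1 := by rw [hδ]; exact h1 y hy
        have hn : new δ ≤ 1 := by
          simp only [hnew]; split_ifs
          · exact hopp
          · norm_num
          · unfold sideShare
            rw [if_pos (c := ∃ y ∈ l, y.s = x.s + δ) ⟨y, hy, hys⟩]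
            split_ifs <;> simp
        omega
      · have hn : new δ = 0 := by
          simp only [hnew]; split_ifs with h h'
          · rw [oppShare, if_pos ⟨y, hy, by rw [hys, h]; abel, hyd⟩]
          · rfl
          · rw [sideShare, if_pos ⟨y, hy, hys, hyd⟩]
        have := h2 y hy (-δ)
        omega
    refine ⟨fun y δ => if y = x then new δ else c y δ, ?_, ?_, ?_, ?_⟩
    · intro y hy δ
      by_cases hyx : y = x
      · simp only [hyx, if_true]; exact hnew2 δ
      · simp only [hyx, if_false]
        exact h2 y ((List.mem_cons.1 hy).resolve_left hyx) δ
    · intro y hy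
      by_cases hyx : y = x
      · simp only [hyx, if_true]; simpa [hnew] using hopp
      · simp only [hyx, if_false]
        exact h1 y ((List.mem_cons.1 hy).resolve_left hyx)
    · intro y hy z hz hyz δ hδ hzs
      rcases List.mem_cons.1 hy with hyx | hyl <;> rcases List.mem_cons.1 hz with hzx | hzl
      · exact absurd (by rw [hyx, hzx]) hyz
      · simp only [hyx, if_true, hxl z hzl, if_false]
        exact hcross z hzl δ (by rw [hzs, hyx])
      · simp only [hzx, if_true, hxl y hyl, if_false]
        have := hcross y hyl (-δ) (by rw [← hzx, hzs]; abel)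
        rw [neg_neg] at this; omega
      · simp only [hxl y hyl, hxl z hzl, if_false]
        exact hp y hyl z hzl hyz δ hδ hzs
    · rw [weightProd, hw, List.map_cons, List.prod_cons]
      congr 1
      · rw [weight, sum_others hxd]
        have e1 : x.τ ≠ -x.d := fun h => d_ne_neg_τ hxd (by rw [h, neg_neg])
        have e2 := (d_ne_τ hxd).symm
        have e3 : x.τ ≠ x.d := e2
        have e4 : -x.τ ≠ x.d := (d_ne_neg_τ hxd).symm
        simp only [if_true, hnew, e1, e2, e4, neg_inj, if_false, ← sub_eq_add_neg]
        rw [shares]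
      · congr 1
        refine List.map_congr_left fun y hy => ?_
        simp only [hxl y hy, if_false]

theorem edge_injOn {l : List State} (hd : ∀ x ∈ l, IsDir x.d) (hl : l.Pairwise Apart)
    {x y : State} (hx : x ∈ l) (hy : y ∈ l) (h : x.edge = y.edge) : x = y := by
  by_contra hne
  have : Std.Symm Apart := ⟨fun _ _ h => h.symm⟩
  have hap := hl.forall hx hy hne
  rcases (edgeAt_eq_iff (hd x hx) (hd y hy)).1 h with ⟨h, -⟩ | ⟨h, -⟩
  exacts [hap.ne h, hap.right h]

/-- Separation keeps the clocks that must ring last disjoint from the clocks that must ring earlier,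
as the conditioning argument requires. -/
theorem edge_ne_edgeAt {l : List State} (hd : ∀ x ∈ l, IsDir x.d) (hl : l.Pairwise Apart)
    {x y : State} (hx : x ∈ l) (hy : y ∈ l) {δ : ℤ × ℤ} (hδ : δ ∈ y.others) :
    x.edge ≠ edgeAt y.s δ := by
  intro h
  by_cases hxy : x = y
  · subst hxy
    rcases (edgeAt_eq_iff (hd x hx) (isDir_of_mem_others (hd x hx) hδ)).1 h with ⟨-, h⟩ | ⟨h, -⟩
    · exact ne_of_mem_others (hd x hx) hδ h.symm
    · exact (hd x hx).ne_zero (by simpa using h)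
  have : Std.Symm Apart := ⟨fun _ _ h => h.symm⟩
  have hap := hl.forall hx hy hxy
  rcases (edgeAt_eq_iff (hd x hx) (isDir_of_mem_others (hd y hy) hδ)).1 h with ⟨h, -⟩ | ⟨h, -⟩
  exacts [hap.ne h, hap.right h]

/-- The probability that all states of `l` are blocking. -/
theorem clockMeasure_blocks_le {l : List State} (hd : ∀ x ∈ l, IsDir x.d)
    (hl : l.Pairwise Apart) :
    clockMeasure Edge {U | ∀ x ∈ l, Blocks U x} ≤ ENNReal.ofReal (weightProd l) := by
  classical
  obtain ⟨c, h2, -, hp, hw⟩ := exists_shares hd hl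
  have hnd : l.Nodup := hl.imp fun h e => h.ne (by rw [e])
  set S := l.toFinset with hS
  have hinj : Set.InjOn State.edge (S : Set State) := fun x hx y hy h =>
    edge_injOn hd hl (by simpa [hS] using hx) (by simpa [hS] using hy) h
  have : Nonempty State := ⟨⟨0, 0, true⟩⟩
  set inv := Function.invFunOn State.edge (S : Set State) with hinv
  have hinv' : ∀ x ∈ S, inv x.edge = x := fun x hx => hinj.leftInvOn_invFunOn hx
  set I := S.image State.edge with hI
  set J := S.biUnion fun x => x.others.image (edgeAt x.s) with hJ
  have hmemJ : ∀ x ∈ S, ∀ δ ∈ x.others, edgeAt x.s δ ∈ J := fun x hx δ hδ =>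
    Finset.mem_biUnion.2 ⟨x, hx, Finset.mem_image_of_mem _ hδ⟩
  have hdS : ∀ x ∈ S, IsDir x.d := fun x hx => hd x (by simpa [hS] using hx)
  have hIJ : Disjoint I J := by
    rw [Finset.disjoint_left]
    intro e he he'
    obtain ⟨x, hx, rfl⟩ := Finset.mem_image.1 he
    obtain ⟨y, hy, hxy⟩ := Finset.mem_biUnion.1 he'
    obtain ⟨δ, hδ, h⟩ := Finset.mem_image.1 hxy
    exact edge_ne_edgeAt hd hl (by simpa [hS] using hx) (by simpa [hS] using hy) hδ h.symm
  -- Shares indexed by state and direction become exponents indexed by pairs of edges; `inv`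
  -- recovers a state from its edge.
  set c' : Edge → Edge → ℕ := fun i j =>
    ∑ δ ∈ (inv i).others, if edgeAt (inv i).s δ = j then c (inv i) δ else 0 with hc'
  have key := clockMeasure_lt_le hIJ (r := fun i j => ∃ δ ∈ (inv i).others, edgeAt (inv i).s δ = j)
    (c := c') ?_ ?_
  · refine (measure_mono ?_).trans (key.trans_eq ?_)
    · intro U hU j hj i hi
      rintro ⟨δ, hδ, rfl⟩
      obtain ⟨x, hx, rfl⟩ := Finset.mem_image.1 hi
      rw [hinv' x hx] at hδ ⊢
      exact hU x (by simpa [hS] using hx) δ (isDir_of_mem_others (hdS x hx) hδ)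
        (ne_of_mem_others (hdS x hx) hδ)
    · rw [hI, Finset.prod_image hinj, hw, ← List.prod_toFinset _ hnd,
        ENNReal.ofReal_prod_of_nonneg fun _ _ => by positivity]
      refine Finset.prod_congr rfl fun x hx => ?_
      congr 4
      simp only [hc', hinv' x hx]
      rw [Finset.sum_comm]
      refine Finset.sum_congr rfl fun δ hδ => ?_
      rw [Finset.sum_ite_eq, if_pos (hmemJ x hx δ hδ)]
  · intro i _ j _ h
    obtain ⟨δ, hδ, h⟩ := Finset.exists_ne_zero_of_sum_ne_zero h
    exact ⟨δ, hδ, by by_contra hne; simp [hne] at h⟩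
  · intro j hj
    obtain ⟨z, hz, hjz⟩ := Finset.mem_biUnion.1 hj
    obtain ⟨ε, hε, rfl⟩ := Finset.mem_image.1 hjz
    have hεd := isDir_of_mem_others (hdS z hz) hε
    rw [hI, Finset.sum_image hinj]
    -- Only states blocking at one of the two end-vertices `z.s`, `z.s + ε` can hold a share of this
    -- edge.
    have hterm : ∀ x ∈ S, c' x.edge (edgeAt z.s ε) ≤
        (if x.s = z.s then c x ε else 0) + if x.s = z.s + ε then c x (-ε) else 0 := by
      intro x hx
      simp only [hc', hinv' x hx]
      have : ∀ δ ∈ x.others, (if edgeAt x.s δ = edgeAt z.s ε then c x δ else 0) ≤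
          (if δ = ε then if x.s = z.s then c x ε else 0 else 0) +
            if δ = -ε then if x.s = z.s + ε then c x (-ε) else 0 else 0 := by
        intro δ hδ
        have hδd := isDir_of_mem_others (hdS x hx) hδ
        by_cases h : edgeAt x.s δ = edgeAt z.s ε
        · rw [if_pos h]
          rcases (edgeAt_eq_iff hδd hεd).1 h with ⟨h1, h2⟩ | ⟨h1, h2⟩
          · rw [if_pos h2, if_pos h1, h2]
            exact Nat.le_add_right _ _
          · have h3 : δ = -ε := by rw [h2, neg_neg]
            have h4 : x.s = z.s + ε := by rw [h1, h2]; abel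
            rw [if_pos h3, if_pos h4, ← h3]
            exact Nat.le_add_left _ _
        · rw [if_neg h]
          exact Nat.zero_le _
      refine (Finset.sum_le_sum this).trans ?_
      rw [Finset.sum_add_distrib, Finset.sum_ite_eq', Finset.sum_ite_eq']
      gcongr <;> split_ifs <;> simp
    refine (Finset.sum_le_sum hterm).trans ?_
    rw [Finset.sum_add_distrib, Finset.sum_eq_single_of_mem z hz]
    · rw [if_pos rfl]
      by_cases hex : ∃ y ∈ S, y.s = z.s + ε
      · obtain ⟨y, hy, hys⟩ := hex
        rw [Finset.sum_eq_single_of_mem y hy, if_pos hys]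
        · refine hp z (by simpa [hS] using hz) y (by simpa [hS] using hy) ?_ ε hεd hys
          rw [hys]; simpa using hεd.ne_zero
        · intro x hx hxy
          rw [if_neg]
          intro h
          have : Std.Symm Apart := ⟨fun _ _ h => h.symm⟩
          exact (hl.forall (by simpa [hS] using hx) (by simpa [hS] using hy) hxy).ne (h.trans hys.symm)
      · push Not at hex
        rw [Finset.sum_eq_zero fun x hx => if_neg (hex x hx), add_zero]
        exact h2 z (by simpa [hS] using hz) ε
    · intro x hx hxz
      rw [if_neg]
      have : Std.Symm Apart := ⟨fun _ _ h => h.symm⟩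
      exact (hl.forall (by simpa [hS] using hx) (by simpa [hS] using hz) hxz).ne

/-- The piece of contour `l ++ [i₀]` has a continuation by `m` states that are all blocking. -/
def Extends (i₀ : State) (m : ℕ) (l : List State) (U : Clocks) : Prop :=
  ∃ l' : List State, l'.length = m ∧ Cons (l' ++ (l ++ [i₀])) ∧ ∀ x ∈ l' ++ l, Blocks U x

theorem cons_of_append {l l' : List State} (h : Cons (l' ++ l)) : Cons l := by
  induction l' with
  | nil => exact h
  | cons x l' ih => exact ih h.tail

/-- A union bound over the successor of the head matches the three terms of `contourSum`. Clocks are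
estimated only at the end, for the complete list. The initial state `i₀` enters the consistency
conditions but is not required to block. -/
theorem clockMeasure_extends_le (i₀ : State) (m : ℕ) {l : List State} (h : Cons (l ++ [i₀])) :
    clockMeasure Edge {U | Extends i₀ m l U} ≤
      ENNReal.ofReal (weightProd l * contourSum i₀ m l) := by
  induction m generalizing l with
  | zero =>
    rw [contourSum, mul_one]
    refine (measure_mono ?_).trans (clockMeasure_blocks_le
      (fun x hx => h.dir x (by simp [hx])) (List.pairwise_append.1 h.apart).1)
    rintro U ⟨l', hl', -, hU⟩
    rw [List.length_eq_zero_iff] at hl'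
    subst hl'
    simpa using hU
  | succ m ih =>
    set x := l.headD i₀ with hx
    have key : ∀ y : State, clockMeasure Edge
        {U | Cons (y :: (l ++ [i₀])) ∧ Extends i₀ m (y :: l) U} ≤
          ENNReal.ofReal (weightProd l * contourTerm i₀ (contourSum i₀ m) l y) := by
      intro y
      by_cases hy : Cons (y :: (l ++ [i₀]))
      · simp only [hy, true_and]
        rw [contourTerm_of_cons hy]
        refine (ih (l := y :: l) hy).trans_eq ?_
        rw [weightProd]; congr 1; ring
      · simp [hy]
    have hnn : ∀ y : State, 0 ≤ weightProd l * contourTerm i₀ (contourSum i₀ m) l y := fun y => by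
      refine mul_nonneg (weightProd_nonneg l) ?_
      unfold contourTerm
      split_ifs
      exacts [mul_nonneg (weight_pos _ _).le (contourSum_nonneg _ _ _), le_rfl]
    rw [contourSum, mul_add, mul_add, ENNReal.ofReal_add (add_nonneg (hnn _) (hnn _)) (hnn _),
      ENNReal.ofReal_add (hnn _) (hnn _)]
    refine (measure_mono ?_).trans ((measure_union_le _ _).trans
      (add_le_add ((measure_union_le _ _).trans (add_le_add (key x.stepA) (key x.stepB)))
        (key x.stepC)))
    rintro U ⟨l', hl', hc, hU⟩
    obtain ⟨l'', y, rfl⟩ : ∃ l'' y, l' = l'' ++ [y] := by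
      rcases List.eq_nil_or_concat l' with rfl | ⟨l'', y, h⟩
      · simp at hl'
      · exact ⟨l'', y, by simpa using h⟩
    have hc' : Cons (l'' ++ (y :: (l ++ [i₀]))) := by simpa using hc
    have hy : Cons (y :: (l ++ [i₀])) := cons_of_append hc'
    have hext : Extends i₀ m (y :: l) U := ⟨l'', by simpa using hl', by simpa using hc',
      fun z hz => hU z (by simpa using hz)⟩
    have hstep : Step x y := by
      have := hy.chain
      rw [append_eq_headD_cons, List.isChain_cons_cons] at this
      exact this.1
    rcases hstep with rfl | rfl | rfl
    · exact .inl (.inl ⟨hy, hext⟩)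
    · exact .inl (.inr ⟨hy, hext⟩)
    · exact .inr ⟨hy, hext⟩

theorem clockMeasure_extends_nil_le (i₀ : State) (m : ℕ) :
    clockMeasure Edge {U | Extends i₀ m [] U} ≤ ENNReal.ofReal (1000 * (99 / 100) ^ m) := by
  by_cases h : Cons [i₀]
  · refine (clockMeasure_extends_le i₀ m h).trans (ENNReal.ofReal_le_ofReal ?_)
    rw [weightProd, one_mul]
    exact contourSum_le m h
  · have : {U : Clocks | Extends i₀ m [] U} = ∅ := by
      ext U
      simp only [Set.mem_ofPred_eq, Set.mem_empty_iff_false, iff_false]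
      rintro ⟨l', -, hc, -⟩
      exact h (cons_of_append hc)
    simp [this]

end State

/-! ### Path counting and well-foundedness of the clock order. -/

/-- The path counting estimate: if every set of `k` distinct vertices is bad with probability at
most `q ^ k`, then long bad paths from a given vertex are unlikely. -/
theorem measure_exists_path_le {V Ω : Type*} [MeasurableSpace Ω] (μ : Measure Ω)
    {nbr : V → Finset V} {D : ℕ} (hD : ∀ v, (nbr v).card ≤ D) {B : V → Set Ω} {q : ENNReal}
    (hB : ∀ l : List V, l.Nodup → μ {ω | ∀ v ∈ l, ω ∈ B v} ≤ q ^ l.length)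
    (m : ℕ) (a : V) (l : List V) :
    μ {ω | ∃ l' : List V, l'.length = m ∧ (l' ++ a :: l).IsChain (fun x y => x ∈ nbr y) ∧
      (l' ++ a :: l).Nodup ∧ ∀ v ∈ l' ++ a :: l, ω ∈ B v} ≤
      (D : ENNReal) ^ m * q ^ (m + l.length + 1) := by
  induction m generalizing a l with
  | zero =>
    by_cases hl : (a :: l).Nodup
    · refine (measure_mono ?_).trans ((hB (a :: l) hl).trans_eq (by simp))
      rintro ω ⟨l', hl', -, -, h⟩
      rw [List.length_eq_zero_iff] at hl'
      subst hl'
      simpa using h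
    · refine (measure_mono (t := ∅) ?_).trans (by simp)
      rintro ω ⟨l', hl', -, h, -⟩
      rw [List.length_eq_zero_iff] at hl'
      subst hl'
      exact hl h
  | succ m ih =>
    calc _ ≤ μ (⋃ b ∈ nbr a, {ω | ∃ l' : List V, l'.length = m ∧
            (l' ++ b :: a :: l).IsChain (fun x y => x ∈ nbr y) ∧
            (l' ++ b :: a :: l).Nodup ∧ ∀ v ∈ l' ++ b :: a :: l, ω ∈ B v}) := by
          refine measure_mono ?_
          rintro ω ⟨l', hl', hc, hn, h⟩
          obtain ⟨l'', b, rfl⟩ : ∃ l'' b, l' = l'' ++ [b] := by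
            rcases List.eq_nil_or_concat l' with rfl | ⟨l'', y, h⟩
            · simp at hl'
            · exact ⟨l'', y, by simpa using h⟩
          simp only [List.append_assoc, List.cons_append, List.nil_append] at hc hn h
          refine Set.mem_biUnion (x := b) ?_ ⟨l'', by simpa using hl', hc, hn, h⟩
          exact (List.isChain_append_cons_cons.1 hc).2.1
      _ ≤ ∑ b ∈ nbr a, (D : ENNReal) ^ m * q ^ (m + (a :: l).length + 1) :=
          (measure_biUnion_finset_le _ _).trans (Finset.sum_le_sum fun b _ => ih b (a :: l))
      _ ≤ (D : ENNReal) * ((D : ENNReal) ^ m * q ^ (m + (a :: l).length + 1)) := by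
          rw [Finset.sum_const, nsmul_eq_mul]
          gcongr
          exact hD a
      _ = _ := by
          rw [← mul_assoc, ← pow_succ', List.length_cons,
            show m + (l.length + 1) + 1 = m + 1 + l.length + 1 by omega]

/-- The edges that share an end-vertex with `e`. -/
noncomputable def edgeNbrs (e : Edge) : Finset Edge := by
  classical
  exact (Finset.univ : Finset (Bool × Bool × Bool)).image fun b =>
    edgeAt (if b.1 then e.1.out.1 else e.1.out.2)
      (if b.2.1 then (if b.2.2 then (1, 0) else (-1, 0)) else (if b.2.2 then (0, 1) else (0, -1)))

theorem card_edgeNbrs_le (e : Edge) : (edgeNbrs e).card ≤ 8 := by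
  classical
  exact Finset.card_image_le.trans (by simp)

theorem mem_edgeNbrs {e f : Edge} {v : ℤ × ℤ} (hf : v ∈ f.1) (he : v ∈ e.1) :
    f ∈ edgeNbrs e := by
  classical
  obtain ⟨δ, hδ, rfl⟩ := exists_edgeAt f hf
  have hv : v = e.1.out.1 ∨ v = e.1.out.2 := by
    rw [← Sym2.mem_iff, Sym2.mk, Prod.mk.eta]
    have := Quot.out_eq e.1
    rwa [show Quot.mk _ e.1.out = e.1 from this]
  unfold edgeNbrs
  rw [Finset.mem_image]
  obtain ⟨b, hb⟩ : ∃ b : Bool, v = if b then e.1.out.1 else e.1.out.2 := by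
    rcases hv with h | h
    exacts [⟨true, by simpa using h⟩, ⟨false, by simpa using h⟩]
  rcases isDir_iff.1 hδ with h | h | h | h
  · exact ⟨(b, true, true), Finset.mem_univ _, by simp only [← hb, h, if_true]⟩
  · exact ⟨(b, true, false), Finset.mem_univ _, by simp [← hb, h]⟩
  · exact ⟨(b, false, true), Finset.mem_univ _, by simp [← hb, h]⟩
  · exact ⟨(b, false, false), Finset.mem_univ _, by simp [← hb, h]⟩

/-- The clock values in the `k`-th interval of length `1/20`. -/
def clockSlot (k : ℕ) : Set unitInterval := {u | ⌊20 * (u : ℝ)⌋₊ = k}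

theorem volume_clockSlot_le (k : ℕ) : volume (clockSlot k) ≤ ENNReal.ofReal (1 / 20) := by
  rw [unitInterval.volume_apply]
  calc volume (Subtype.val '' clockSlot k)
      ≤ volume (Set.Icc ((k : ℝ) / 20) ((k + 1) / 20)) := by
        refine measure_mono ?_
        rintro _ ⟨u, hu, rfl⟩
        have h0 : (0 : ℝ) ≤ 20 * (u : ℝ) := mul_nonneg (by norm_num) u.2.1
        have h1 := Nat.floor_le h0
        have h2 := Nat.lt_floor_add_one (20 * (u : ℝ))
        rw [show ⌊20 * (u : ℝ)⌋₊ = k from hu] at h1 h2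
        constructor <;> linarith
    _ = _ := by rw [Real.volume_Icc]; congr 1; ring

theorem measurableSet_clockSlot (k : ℕ) : MeasurableSet (clockSlot k) := by
  have : Measurable fun u : unitInterval => ⌊20 * (u : ℝ)⌋₊ :=
    Nat.measurable_floor.comp (measurable_subtype_coe.const_mul 20)
  exact this (measurableSet_singleton k)

/-- No infinite path of adjacent edges has all its clocks in the same slot. -/
theorem clockMeasure_slot_path (e : Edge) (k : ℕ) :
    clockMeasure Edge {U | ∀ m : ℕ, ∃ l' : List Edge, l'.length = m ∧
      (l' ++ [e]).IsChain (fun x y => x ∈ edgeNbrs y) ∧ (l' ++ [e]).Nodup ∧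
      ∀ f ∈ l' ++ [e], U f ∈ clockSlot k} = 0 := by
  classical
  have hB : ∀ l : List Edge, l.Nodup →
      clockMeasure Edge {U | ∀ f ∈ l, U ∈ {U : Clocks | U f ∈ clockSlot k}} ≤
        (ENNReal.ofReal (1 / 20)) ^ l.length := by
    intro l hl
    have : {U : Clocks | ∀ f ∈ l, U ∈ {U : Clocks | U f ∈ clockSlot k}} =
        Set.pi (l.toFinset : Set Edge) fun _ => clockSlot k := by
      ext U; simp [Set.mem_pi]
    rw [this, Measure.infinitePi_pi _ fun _ _ => measurableSet_clockSlot k,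
      Finset.prod_const, List.toFinset_card_of_nodup hl]
    exact pow_le_pow_left' (volume_clockSlot_le k) _
  have hle : ∀ m : ℕ, clockMeasure Edge {U | ∀ m : ℕ, ∃ l' : List Edge, l'.length = m ∧
      (l' ++ [e]).IsChain (fun x y => x ∈ edgeNbrs y) ∧ (l' ++ [e]).Nodup ∧
      ∀ f ∈ l' ++ [e], U f ∈ clockSlot k} ≤ (ENNReal.ofReal (8 / 20)) ^ m := by
    intro m
    refine (measure_mono ?_).trans
      ((measure_exists_path_le _ card_edgeNbrs_le hB m e []).trans ?_)
    · intro U hU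
      exact hU m
    have : ((8 : ℕ) : ENNReal) = ENNReal.ofReal 8 := by simp
    rw [List.length_nil, add_zero, pow_succ, ← mul_assoc, ← mul_pow, this,
      ← ENNReal.ofReal_mul (by norm_num)]
    -- An edge has at most 8 candidates for the next one, so any slot length below 1/8 would do.
    calc _ ≤ ENNReal.ofReal (8 * (1 / 20)) ^ m * 1 := by
          gcongr
          rw [ENNReal.ofReal_le_one]; norm_num
      _ = _ := by rw [mul_one]; norm_num
  have hlim : Filter.Tendsto (fun m : ℕ => (ENNReal.ofReal (8 / 20)) ^ m) Filter.atTop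
      (nhds 0) := ENNReal.tendsto_pow_atTop_nhds_zero_of_lt_one (by
        rw [ENNReal.ofReal_lt_one]; norm_num)
  exact le_antisymm (ge_of_tendsto' hlim hle) zero_le

instance : Countable Edge := inferInstanceAs (Countable (lattice.edgeSet))

/-- Almost surely there is no infinite chain of adjacent edges with decreasing clocks. -/
theorem ae_wellFounded : ∀ᵐ U ∂clockMeasure Edge, WellFounded (Earlier U) := by
  have h : ∀ᵐ U ∂clockMeasure Edge, ∀ e k, ¬ ∀ m : ℕ, ∃ l' : List Edge, l'.length = m ∧
      (l' ++ [e]).IsChain (fun x y => x ∈ edgeNbrs y) ∧ (l' ++ [e]).Nodup ∧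
      ∀ f ∈ l' ++ [e], U f ∈ clockSlot k := by
    rw [ae_all_iff]; intro e
    rw [ae_all_iff]; intro k
    rw [ae_iff]
    simpa only [not_not] using clockMeasure_slot_path e k
  filter_upwards [h] with U hU
  rw [wellFounded_iff_isEmpty_descending_chain]
  refine ⟨fun ⟨f, hf⟩ => ?_⟩
  have hanti : StrictAnti fun n => U (f n) := strictAnti_nat_of_succ_lt fun n => (hf n).2
  -- Slot numbers along decreasing clocks do not increase; as natural numbers they are eventually
  -- constant.
  obtain ⟨N, hN⟩ : ∃ N, ∀ n ≥ N, U (f n) ∈ clockSlot ⌊20 * (U (f N) : ℝ)⌋₊ := by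
    obtain ⟨N, -, hN⟩ := WellFounded.has_min (measure fun n => ⌊20 * (U (f n) : ℝ)⌋₊).wf
      Set.univ ⟨0, trivial⟩
    refine ⟨N, fun n hn => le_antisymm (Nat.floor_mono ?_) (not_lt.1 (hN n trivial))⟩
    exact mul_le_mul_of_nonneg_left (hanti.antitone hn) (by norm_num)
  refine hU (f N) ⌊20 * (U (f N) : ℝ)⌋₊ fun m => ?_
  -- The recorded head allows the next edge to be prepended; the recorded indices show that it is
  -- new, because clocks strictly decrease.
  suffices H : ∀ m, ∃ l' : List Edge, l'.length = m ∧ (∃ l'', l' ++ [f N] = f (N + m) :: l'') ∧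
      (l' ++ [f N]).IsChain (fun x y => x ∈ edgeNbrs y) ∧ (l' ++ [f N]).Nodup ∧
      ∀ e ∈ l' ++ [f N], ∃ j ≤ m, e = f (N + j) by
    obtain ⟨l', h1, -, h2, h3, h4⟩ := H m
    refine ⟨l', h1, h2, h3, fun e he => ?_⟩
    obtain ⟨j, -, rfl⟩ := h4 e he
    exact hN _ (by omega)
  intro m
  induction m with
  | zero => exact ⟨[], by simp⟩
  | succ m ih =>
    obtain ⟨l', h1, ⟨l'', h0⟩, h2, h3, h4⟩ := ih
    refine ⟨f (N + (m + 1)) :: l', by simp [h1], ⟨_, rfl⟩, ?_, ?_, ?_⟩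
    · rw [List.cons_append, h0, List.isChain_cons_cons]
      obtain ⟨⟨v, hv, hv'⟩, -⟩ := hf (N + m)
      exact ⟨mem_edgeNbrs hv hv', h0 ▸ h2⟩
    · rw [List.cons_append, List.nodup_cons]
      refine ⟨fun hmem => ?_, h3⟩
      obtain ⟨j, hj, h⟩ := h4 _ hmem
      have : U (f (N + (m + 1))) < U (f (N + j)) := hanti (by omega)
      rw [h] at this
      exact lt_irrefl _ this
    · intro e he
      rcases List.mem_cons.1 he with rfl | he
      · exact ⟨m + 1, le_rfl, rfl⟩
      · obtain ⟨j, hj, rfl⟩ := h4 e he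
        exact ⟨j, by omega, rfl⟩

/-! ### Measurability of the configuration. -/

theorem succeeds_iff {U : Clocks} (h : WellFounded (Earlier U)) (κ : Constraints) (e : Edge) :
    Succeeds U κ e ↔ rule U κ e fun f _ => Succeeds U κ f := by
  simp only [Succeeds, dif_pos h]
  rw [h.fix_eq]

/-- The result of `n` iterations of the opening rule. -/
def succeedsApprox : ℕ → Clocks × Constraints → Edge → Prop
  | 0, _, _ => False
  | n + 1, x, e => rule x.1 x.2 e fun f _ => succeedsApprox n x f

/-- Turns a degree condition into a union over finite sets of edges, of which there are countably
many. -/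
theorem natCast_le_encard_iff {α : Type*} {s : Set α} {k : ℕ} :
    (k : ℕ∞) ≤ s.encard ↔ ∃ T : Finset α, T.card = k ∧ ∀ a ∈ T, a ∈ s := by
  constructor
  · intro h
    obtain ⟨t, hts, ht⟩ := Set.exists_subset_encard_eq h
    have hfin : t.Finite := Set.finite_of_encard_eq_coe ht
    refine ⟨hfin.toFinset, ?_, fun a ha => hts (by simpa using ha)⟩
    rw [hfin.encard_eq_coe_toFinset_card] at ht
    exact_mod_cast ht
  · rintro ⟨T, rfl, hT⟩
    rw [← Set.encard_coe_eq_coe_finsetCard]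
    exact Set.encard_le_encard hT

theorem measurableSet_succeedsApprox (n : ℕ) (e : Edge) :
    MeasurableSet {x | succeedsApprox n x e} := by
  induction n generalizing e with
  | zero => simp [succeedsApprox]
  | succ n ih =>
    have key : ∀ v : ℤ × ℤ, MeasurableSet {x : Clocks × Constraints |
        {f : Edge | ∃ (_ : v ∈ f.1) (_ : x.1 f < x.1 e), succeedsApprox n x f}.encard
          < ((x.2 v : ℕ) : ℕ∞)} := by
      intro v
      have : {x : Clocks × Constraints |
          {f : Edge | ∃ (_ : v ∈ f.1) (_ : x.1 f < x.1 e), succeedsApprox n x f}.encard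
            < ((x.2 v : ℕ) : ℕ∞)} = ⋃ k : Fin 4, {x | x.2 v = k} ∩
          (⋃ T : {T : Finset Edge // T.card = (k : ℕ)}, ⋂ f ∈ T.1,
            {x : Clocks × Constraints | v ∈ f.1 ∧ x.1 f < x.1 e ∧ succeedsApprox n x f})ᶜ := by
        ext x
        simp only [Set.mem_ofPred_eq, Set.mem_iUnion, Set.mem_inter_iff, Set.mem_compl_iff,
          Set.mem_iInter, exists_eq_left', ← not_le, natCast_le_encard_iff, Subtype.exists,
          exists_prop]
      rw [this]
      refine .iUnion fun k => .inter ?_ (.compl (.iUnion fun T => .biInter T.1.countable_toSet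
        fun f _ => ?_))
      · have hm : Measurable fun x : Clocks × Constraints => x.2 v := by fun_prop
        exact hm (measurableSet_singleton k)
      · have hlt : MeasurableSet {x : Clocks × Constraints | x.1 f < x.1 e} :=
          measurableSet_lt (by fun_prop) (by fun_prop)
        exact (MeasurableSet.const _).inter (hlt.inter (ih f))
    have : {x | succeedsApprox (n + 1) x e} = ⋂ v : ℤ × ℤ, ⋂ _ : v ∈ e.1,
        {x : Clocks × Constraints |
        {f : Edge | ∃ (_ : v ∈ f.1) (_ : x.1 f < x.1 e), succeedsApprox n x f}.encard
          < ((x.2 v : ℕ) : ℕ∞)} := by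
      ext x
      simp only [succeedsApprox, rule, Set.mem_ofPred_eq, Set.mem_iInter]
    rw [this]
    exact .iInter fun v => .iInter fun _ => key v

/-- Induction along the clock order: the outcome at `e` depends on finitely many earlier adjacent
edges, so one iteration beyond their largest threshold suffices. -/
theorem exists_succeedsApprox_iff {x : Clocks × Constraints} (h : WellFounded (Earlier x.1))
    (e : Edge) : ∃ N, ∀ n ≥ N, succeedsApprox n x e ↔ Succeeds x.1 x.2 e := by
  induction e using h.induction with
  | _ e ih =>
    choose! N hN using ih
    refine ⟨(edgeNbrs e).sup N + 1, fun n hn => ?_⟩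
    obtain ⟨n, rfl⟩ : ∃ k, n = k + 1 := ⟨n - 1, by omega⟩
    rw [succeedsApprox, succeeds_iff h]
    unfold rule
    refine forall₂_congr fun v hv => ?_
    rw [show {f : Edge | ∃ (_ : v ∈ f.1) (_ : x.1 f < x.1 e), succeedsApprox n x f} =
      {f : Edge | ∃ (_ : v ∈ f.1) (_ : x.1 f < x.1 e), Succeeds x.1 x.2 f} from ?_]
    ext f
    simp only [Set.mem_ofPred_eq, exists_prop]
    refine and_congr_right fun hf => and_congr_right fun hlt => ?_
    refine hN f ⟨⟨v, hf, hv⟩, hlt⟩ n ?_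
    have := Finset.le_sup (f := N) (mem_edgeNbrs hf hv)
    omega

theorem environment_fst {ρ : PMF (Fin 4)} {p : Clocks → Prop}
    (h : ∀ᵐ U ∂clockMeasure Edge, p U) : ∀ᵐ x ∂environment ρ, p x.1 :=
  Measure.quasiMeasurePreserving_fst.ae h

/-- The eventual value of the iteration is measurable and agrees with `config t` wherever the clock
order is well-founded. -/
theorem aemeasurable_config (ρ : PMF (Fin 4)) (t : ℝ) :
    AEMeasurable (config t) (environment ρ) := by
  classical
  refine ⟨fun x e => decide ((x.1 e : ℝ) ≤ t ∧ ∃ N, ∀ n ≥ N, succeedsApprox n x e), ?_, ?_⟩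
  · refine measurable_pi_lambda _ fun e => measurable_to_bool ?_
    have : (fun x : Clocks × Constraints =>
        decide ((x.1 e : ℝ) ≤ t ∧ ∃ N, ∀ n ≥ N, succeedsApprox n x e)) ⁻¹' {true} =
        {x | (x.1 e : ℝ) ≤ t} ∩ ⋃ N, ⋂ n, ⋂ _ : n ≥ N, {x | succeedsApprox n x e} := by
      ext x; simp
    rw [this]
    refine .inter ?_ (.iUnion fun N => .iInter fun n => .iInter fun _ =>
      measurableSet_succeedsApprox n e)
    exact measurableSet_le (measurable_subtype_coe.comp
      ((measurable_pi_apply e).comp measurable_fst)) measurable_const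
  · filter_upwards [environment_fst ae_wellFounded] with x hx
    ext e
    simp only [config, decide_eq_decide]
    refine and_congr_right fun _ => ?_
    obtain ⟨N, hN⟩ := exists_succeedsApprox_iff hx e
    constructor
    · exact fun h => ⟨N, fun n hn => (hN n hn).2 h⟩
    · rintro ⟨M, hM⟩
      exact (hN (max N M) (le_max_left _ _)).1 (hM _ (le_max_right _ _))

/-! ### Blocking vertices. -/

/-- If all constraints are `3` nearby, a closed edge whose clock has rung has an end-vertex at
which all other edges opened before. -/
theorem exists_blocking {t : ℝ} {x : Clocks × Constraints} (h : WellFounded (Earlier x.1))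
    {e : Edge} (he : config t x e = false) (ht : (x.1 e : ℝ) ≤ t) (hκ : ∀ v ∈ e.1, x.2 v = 3) :
    ∃ v ∈ e.1, ∀ f : Edge, v ∈ f.1 → f ≠ e → config t x f = true ∧ x.1 f < x.1 e := by
  have h1 : ¬ (config t x e = true) := by simp [he]
  rw [config_eq_true_iff t x h] at h1
  push Not at h1
  obtain ⟨v, hv, hdeg⟩ := h1 ht
  refine ⟨v, hv, ?_⟩
  rw [hκ v hv] at hdeg
  obtain ⟨δ, hδ, hδe⟩ := exists_edgeAt e hv
  set A := {f : Edge | v ∈ f.1 ∧ ∃ r < (x.1 e : ℝ), config r x f = true} with hA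
  have hcfg : ∀ (r : ℝ) (f : Edge), config r x f = true ↔ (x.1 f : ℝ) ≤ r ∧ Succeeds x.1 x.2 f := by
    intro r f; simp [config]
  set B := {f : Edge | v ∈ f.1 ∧ f ≠ e} with hB
  have hAB : A ⊆ B := by
    rintro f ⟨hf, r, hr, hc⟩
    refine ⟨hf, ?_⟩
    rintro rfl
    exact absurd ((hcfg r f).1 hc).1 (not_le.2 hr)
  have hBle : B ⊆ ((({-δ, rot δ, -rot δ} : Finset (ℤ × ℤ)).image (edgeAt v) : Finset Edge) :
      Set Edge) := by
    rintro f ⟨hf, hfe⟩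
    obtain ⟨ε, hε, rfl⟩ := exists_edgeAt f hf
    rw [Finset.mem_coe, Finset.mem_image]
    refine ⟨ε, ?_, rfl⟩
    rcases hδ.cases hε with rfl | h | h | h
    · exact absurd hδe.symm hfe
    all_goals simp [h]
  have hBfin : B.Finite := (Finset.finite_toSet _).subset hBle
  have hBcard : B.encard ≤ 3 := by
    refine (Set.encard_le_encard hBle).trans ?_
    rw [Set.encard_coe_eq_coe_finsetCard]
    exact_mod_cast Finset.card_image_le.trans Finset.card_le_three
  -- At least three edges at `v` opened before `e`, and there are only three others.
  have hEq : A = B := by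
    refine (hBfin.subset hAB).eq_of_subset_of_encard_le hAB (hBcard.trans ?_)
    simpa [degBefore, hA] using hdeg
  intro f hf hfe
  have : f ∈ A := by rw [hEq]; exact ⟨hf, hfe⟩
  obtain ⟨-, r, hr, hc⟩ := this
  have hc' := (hcfg r f).1 hc
  have hlt : (x.1 f : ℝ) < x.1 e := hc'.1.trans_lt hr
  exact ⟨(hcfg t f).2 ⟨hlt.le.trans ht, hc'.2⟩, hlt⟩

/-! ### Boundary curves of finite regions. -/

/-- The boundary edges of `C`, oriented outwards: pairs `(c, δ)` with `c ∈ C` and `c + δ ∉ C`. -/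
def boundary (C : Set (ℤ × ℤ)) : Set ((ℤ × ℤ) × (ℤ × ℤ)) :=
  {p | IsDir p.2 ∧ p.1 ∈ C ∧ p.1 + p.2 ∉ C}

open Classical in
/-- The boundary edge that follows `p` if the boundary of `C` is traversed with `C` on the left. -/
noncomputable def next (C : Set (ℤ × ℤ)) (p : (ℤ × ℤ) × (ℤ × ℤ)) : (ℤ × ℤ) × (ℤ × ℤ) :=
  if p.1 + rot p.2 ∉ C then (p.1, rot p.2)
  else if p.1 + p.2 + rot p.2 ∉ C then (p.1 + rot p.2, p.2)
  else (p.1 + p.2 + rot p.2, -rot p.2)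

theorem next_cases (C : Set (ℤ × ℤ)) (p : (ℤ × ℤ) × (ℤ × ℤ)) :
    (p.1 + rot p.2 ∉ C ∧ next C p = (p.1, rot p.2)) ∨
    (p.1 + rot p.2 ∈ C ∧ p.1 + p.2 + rot p.2 ∉ C ∧ next C p = (p.1 + rot p.2, p.2)) ∨
    (p.1 + rot p.2 ∈ C ∧ p.1 + p.2 + rot p.2 ∈ C ∧
      next C p = (p.1 + p.2 + rot p.2, -rot p.2)) := by
  unfold next
  by_cases h1 : p.1 + rot p.2 ∈ C <;> by_cases h2 : p.1 + p.2 + rot p.2 ∈ C <;> simp [h1, h2]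

theorem next_mem {C : Set (ℤ × ℤ)} {p : (ℤ × ℤ) × (ℤ × ℤ)} (hp : p ∈ boundary C) :
    next C p ∈ boundary C := by
  obtain ⟨hd, h1, h2⟩ := hp
  rcases next_cases C p with ⟨h, he⟩ | ⟨h, h', he⟩ | ⟨h, h', he⟩ <;> rw [he]
  · exact ⟨hd.rot, h1, h⟩
  · exact ⟨hd, h, by simpa [add_right_comm] using h'⟩
  · exact ⟨hd.rot.neg, h', by simpa using h2⟩

/-- If the two edges moved on by different rules, some vertex would lie both inside and outside `C`.
-/
theorem next_injOn (C : Set (ℤ × ℤ)) : Set.InjOn (next C) (boundary C) := by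
  rintro ⟨c, δ⟩ ⟨hd, h1, h2⟩ ⟨c', δ'⟩ ⟨hd', h1', h2'⟩ h
  rcases next_cases C (c, δ) with ⟨g, he⟩ | ⟨g, g', he⟩ | ⟨g, g', he⟩ <;>
  rcases next_cases C (c', δ') with ⟨k, ke⟩ | ⟨k, k', ke⟩ | ⟨k, k', ke⟩ <;>
  rw [he, ke, Prod.mk.injEq] at h <;> obtain ⟨ha, hb⟩ := h <;> simp only at *
  · have : δ = δ' := by have := congrArg rot hb; simpa using this
    rw [ha, this]
  · exfalso; apply h2; rw [ha, ← hb]; simpa using h1'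
  · exfalso; apply h2; rw [ha]
    have : δ = -δ' := by
      have := congrArg rot hb; simp at this; rw [← this, neg_neg]
    rw [this, show c' + δ' + rot δ' + -δ' = c' + rot δ' by abel]; exact k
  · exfalso; apply h2'; rw [← ha, hb]; simpa using h1
  · rw [hb] at ha ⊢; rw [add_right_cancel ha]
  · exfalso
    have e1 : rot δ = δ' := by rw [hb]; simp
    have e2 : c = c' + rot δ' := by
      have := ha; rw [e1] at this
      have h3 : c + δ' = c' + rot δ' + δ' := by rw [this]; abel
      exact add_right_cancel h3
    apply h2; rw [e2, hb]; simpa using h1'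
  · exfalso; apply h2'; rw [← ha]
    have : δ' = -δ := by
      have := congrArg rot hb; simp at this; rw [this, neg_neg]
    rw [this, show c + δ + rot δ + -δ = c + rot δ by abel]; exact g
  · exfalso
    have e1 : rot δ' = δ := by rw [← hb]; simp
    have e2 : c' = c + rot δ := by
      have := ha.symm; rw [e1] at this
      have h3 : c' + δ = c + rot δ + δ := by rw [this]; abel
      exact add_right_cancel h3
    apply h2'; rw [e2, ← hb]; simpa using h1
  · have : δ = δ' := by have := congrArg rot hb; simpa using this
    subst this
    rw [add_right_cancel (add_right_cancel ha)]

theorem finite_boundary {C : Set (ℤ × ℤ)} (hC : C.Finite) : (boundary C).Finite := by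
  have : ({v : ℤ × ℤ | IsDir v}).Finite := by
    refine (Set.toFinite {(1, 0), (-1, 0), (0, 1), (0, -1)}).subset fun v hv => ?_
    simpa using isDir_iff.1 hv
  exact (hC.prod this).subset fun p hp => ⟨hp.2.1, hp.1⟩

/-- Twice the height of the starting point of the dual of a boundary edge. -/
def height (p : (ℤ × ℤ) × (ℤ × ℤ)) : ℤ := 2 * p.1.2 + p.2.2 - p.2.1

/-- Duals of consecutive boundary edges are joined head to tail: the right-hand side is twice the
height of the end point of the dual of `p`. -/
theorem height_next (C : Set (ℤ × ℤ)) (p : (ℤ × ℤ) × (ℤ × ℤ)) :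
    height (next C p) = 2 * p.1.2 + p.2.2 + p.2.1 := by
  rcases next_cases C p with ⟨-, he⟩ | ⟨-, -, he⟩ | ⟨-, -, he⟩ <;> rw [he] <;>
    simp [height, rot] <;> ring

theorem next_fst_sub_le {C : Set (ℤ × ℤ)} {p : (ℤ × ℤ) × (ℤ × ℤ)} (hp : IsDir p.2) :
    |(next C p).1.1 - p.1.1| ≤ 1 ∧ |(next C p).1.2 - p.1.2| ≤ 1 := by
  rcases next_cases C p with ⟨-, he⟩ | ⟨-, -, he⟩ | ⟨-, -, he⟩ <;> rw [he] <;>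
    rcases isDir_iff.1 hp with h | h | h | h <;> simp [rot, h]

/-- Crossings of the horizontal axis, signed by their direction. -/
def crossing (p : (ℤ × ℤ) × (ℤ × ℤ)) : ℤ := if p.1.2 = 0 ∧ p.2.2 = 0 then p.2.1 else 0

/-- Heights are odd, so the axis is crossed exactly when their sign changes. Over a set permuted by
`next C` the differences cancel. -/
theorem crossing_eq {C : Set (ℤ × ℤ)} {p : (ℤ × ℤ) × (ℤ × ℤ)} (hp : IsDir p.2) :
    crossing p = (if 0 < height (next C p) then 1 else 0) - if 0 < height p then 1 else 0 := by
  rw [height_next, height, crossing]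
  obtain ⟨⟨a, b⟩, δ⟩ := p
  rcases isDir_iff.1 hp with h | h | h | h <;> dsimp only at h <;> subst h <;> dsimp only <;>
    split_ifs <;> omega

/-- Crossings of the right half of the horizontal axis, up to distance `M`. -/
def rightCrossing (M : ℕ) (p : (ℤ × ℤ) × (ℤ × ℤ)) : ℤ :=
  ∑ k ∈ Finset.range M, ((if p = (((k : ℤ), 0), (1, 0)) then 1 else 0) -
    if p = (((k : ℤ) + 1, 0), (-1, 0)) then 1 else 0)

theorem rightCrossing_eq_crossing {M : ℕ} {p : (ℤ × ℤ) × (ℤ × ℤ)} (hp : IsDir p.2)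
    (h1 : 0 < p.1.1) (hM : p.1.1 < M) : rightCrossing M p = crossing p := by
  obtain ⟨⟨a, b⟩, δ⟩ := p
  simp only at h1 hM hp
  rw [rightCrossing, crossing, Finset.sum_sub_distrib]
  obtain ⟨n, rfl⟩ : ∃ n : ℕ, a = n + 1 := ⟨(a - 1).toNat, by omega⟩
  by_cases hb : b = 0
  swap
  · simp [hb]
  subst hb
  rcases isDir_iff.1 hp with rfl | rfl | rfl | rfl
  · rw [Finset.sum_eq_single (n + 1), Finset.sum_eq_zero]
    · simp
    · intro k _; simp
    · intro k _ hk
      rw [if_neg]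
      simp only [Prod.mk.injEq, and_true]
      omega
    · intro h; simp only [Finset.mem_range] at h; omega
  · rw [Finset.sum_eq_zero (by intro k _; simp), Finset.sum_eq_single n]
    · simp
    · intro k _ hk
      rw [if_neg]
      simp only [Prod.mk.injEq, and_true]
      omega
    · intro h; simp only [Finset.mem_range] at h; omega
  · simp
  · simp

/-- Membership in `C` telescopes along the axis, from the origin inside to `(M, 0)` outside. -/
theorem sum_rightCrossing {C : Set (ℤ × ℤ)} (hC : C.Finite) (h0 : (0, 0) ∈ C) {M : ℕ}
    (hM : ((M : ℤ), 0) ∉ C) : ∑ p ∈ (finite_boundary hC).toFinset, rightCrossing M p = 1 := by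
  classical
  unfold rightCrossing
  rw [Finset.sum_comm]
  have : ∀ k ∈ Finset.range M, ∑ p ∈ (finite_boundary hC).toFinset,
      ((if p = (((k : ℤ), 0), (1, 0)) then (1 : ℤ) else 0) -
        if p = (((k : ℤ) + 1, 0), (-1, 0)) then 1 else 0) =
      (if ((k : ℤ), (0 : ℤ)) ∈ C then 1 else 0) -
        if (((k + 1 : ℕ) : ℤ), (0 : ℤ)) ∈ C then 1 else 0 := by
    intro k _
    rw [Finset.sum_sub_distrib, Finset.sum_ite_eq', Finset.sum_ite_eq']
    simp only [Set.Finite.mem_toFinset, boundary, Set.mem_ofPred_eq, isDir_iff]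
    by_cases h1 : ((k : ℤ), (0 : ℤ)) ∈ C <;> by_cases h2 : ((k : ℤ) + 1, (0 : ℤ)) ∈ C <;>
      simp [h1, h2]
  rw [Finset.sum_congr rfl this,
    Finset.sum_range_sub' (fun k : ℕ => if ((k : ℤ), (0 : ℤ)) ∈ C then (1 : ℤ) else 0)]
  simp [h0, hM]

/-- A finite region that contains a box has a boundary curve from the right half of the
horizontal axis to its left half. -/
theorem exists_contour {C : Set (ℤ × ℤ)} (hC : C.Finite) {N : ℕ} (hN : 1 ≤ N)
    (hbox : ∀ a : ℤ, |a| ≤ N → (a, 0) ∈ C) :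
    ∃ p : (ℤ × ℤ) × (ℤ × ℤ), p ∈ boundary C ∧ p.1.2 = 0 ∧ (N : ℤ) ≤ p.1.1 ∧
      ∃ j : ℕ, ((next C)^[j] p).1.1 ≤ -N := by
  classical
  obtain ⟨M, hM⟩ : ∃ M : ℕ, ∀ v ∈ C, v.1 < M := by
    obtain ⟨b, hb⟩ := (hC.image Prod.fst).bddAbove
    exact ⟨(b + 1).toNat, fun v hv => by
      have := hb (Set.mem_image_of_mem _ hv); omega⟩
  set D := (finite_boundary hC).toFinset with hD
  have hDm : ∀ p, p ∈ D ↔ p ∈ boundary C := by simp [hD]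
  by_contra! hcon
  -- The orbits of all boundary edges on the right half of the axis. If none reached the left, their
  -- signed crossings would sum to 0 by invariance and to 1 by telescoping.
  set Q := D.filter fun p => ∃ q ∈ D, ∃ j : ℕ, (next C)^[j] q = p ∧ rightCrossing M q ≠ 0 with hQ
  have hmaps : ∀ p ∈ Q, next C p ∈ Q := by
    intro p hp
    rw [hQ, Finset.mem_filter] at hp ⊢
    obtain ⟨hpD, q, hq, j, hj, hr⟩ := hp
    refine ⟨(hDm _).2 (next_mem ((hDm _).1 hpD)), q, hq, j + 1, ?_, hr⟩
    rw [Function.iterate_succ_apply', hj]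
  have hinj : Set.InjOn (next C) Q := (next_injOn C).mono fun p hp =>
    (hDm p).1 (Finset.mem_filter.1 hp).1
  have himage : Q.image (next C) = Q :=
    Finset.eq_of_subset_of_card_le (fun p hp => by
      obtain ⟨q, hq, rfl⟩ := Finset.mem_image.1 hp
      exact hmaps q hq) (Finset.card_image_of_injOn hinj).ge
  have hzero : ∑ p ∈ Q, crossing p = 0 := by
    have e : ∀ p ∈ Q, crossing p =
        (if 0 < height (next C p) then (1 : ℤ) else 0) - if 0 < height p then 1 else 0 :=
      fun p hp => crossing_eq ((hDm p).1 (Finset.mem_filter.1 hp).1).1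
    rw [Finset.sum_congr rfl e, Finset.sum_sub_distrib, sub_eq_zero]
    conv_rhs => rw [← himage]
    rw [Finset.sum_image hinj]
  have hone : ∑ p ∈ Q, rightCrossing M p = 1 := by
    rw [← sum_rightCrossing hC (hbox 0 (by simp)) (M := M)
      (fun h => absurd (hM _ h) (by simp)), ← hD]
    refine Finset.sum_subset (Finset.filter_subset _ _) fun p hp hpQ => ?_
    by_contra hne
    exact hpQ (Finset.mem_filter.2 ⟨hp, p, hp, 0, rfl, hne⟩)
  -- All crossings of these orbits lie on the right: an edge along the axis that starts strictly
  -- right of `-N` and not right of 0 has both ends in the box, hence is no boundary edge.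
  have hEq : ∀ p ∈ Q, crossing p = rightCrossing M p := by
    intro p hp
    rw [hQ, Finset.mem_filter] at hp
    obtain ⟨hpD, q, hq, j, hj, hr⟩ := hp
    have hpB := (hDm p).1 hpD
    have hqB := (hDm q).1 hq
    have hq' : q.1.2 = 0 ∧ (N : ℤ) ≤ q.1.1 := by
      obtain ⟨k, hk, hne⟩ := Finset.exists_ne_zero_of_sum_ne_zero hr
      have hout : ∀ a : ℤ, 0 ≤ a → (a, (0 : ℤ)) ∉ C → (N : ℤ) < a := fun a ha h => by
        by_contra! hle
        exact h (hbox a (by rwa [abs_of_nonneg ha]))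
      by_cases h1 : q = (((k : ℤ), 0), (1, 0))
      · have := hqB.2.2
        rw [h1] at this ⊢
        have := hout (k + 1) (by positivity) (by simpa using this)
        exact ⟨rfl, by simp only; omega⟩
      · by_cases h2 : q = (((k : ℤ) + 1, 0), (-1, 0))
        · have := hqB.2.2
          rw [h2] at this ⊢
          have := hout k (by positivity) (by simpa using this)
          exact ⟨rfl, by simp only; omega⟩
        · simp [h1, h2] at hne
    have hfar := hcon q hqB hq'.1 hq'.2 j
    rw [hj] at hfar
    by_cases hpos : 0 < p.1.1
    · exact (rightCrossing_eq_crossing hpB.1 hpos (hM _ hpB.2.1)).symm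
    · have hc : crossing p = 0 := by
        unfold crossing
        split_ifs with h
        · exfalso
          have h2 := hpB.2.2
          have h3 := isDir_iff.1 hpB.1
          apply h2
          have : p.1 + p.2 = (p.1.1 + p.2.1, 0) := by ext <;> simp [h.1, h.2]
          rw [this]
          apply hbox
          have h4 : p.2.1 = 1 ∨ p.2.1 = -1 := by
            rcases h3 with h' | h' | h' | h' <;> simp [h'] at h ⊢
          rw [abs_le]
          omega
        · rfl
      have hr' : rightCrossing M p = 0 := by
        unfold rightCrossing
        refine Finset.sum_eq_zero fun k _ => ?_
        rw [if_neg, if_neg]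
        · simp
        · rintro rfl; simp at hpos
        · rintro rfl
          simp only [not_lt] at hpos
          have : k = 0 := by omega
          subst this
          have h2 := hpB.2.2
          apply h2
          simp only [Prod.mk_add_mk]
          apply hbox
          simpa using hN
      rw [hc, hr']
  rw [Finset.sum_congr rfl hEq, hone] at hzero
  exact one_ne_zero hzero

/-! ### Boundary curves as sequences of states. -/

namespace State

/-- The state of the boundary edge `p` that is blocked at its inner (`true`) or outer (`false`)
end-vertex. -/
def ofBoundary (b : Bool) (p : (ℤ × ℤ) × (ℤ × ℤ)) : State :=
  if b then ⟨p.1, p.2, true⟩ else ⟨p.1 + p.2, -p.2, false⟩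

/-- The boundary edge of a state. -/
def toBoundary (x : State) : (ℤ × ℤ) × (ℤ × ℤ) := if x.χ then (x.s, x.d) else (x.s + x.d, -x.d)

@[simp] theorem toBoundary_ofBoundary (b : Bool) (p : (ℤ × ℤ) × (ℤ × ℤ)) :
    (ofBoundary b p).toBoundary = p := by
  cases b <;> simp [ofBoundary, toBoundary]

theorem isDir_ofBoundary {b : Bool} {p : (ℤ × ℤ) × (ℤ × ℤ)} (h : IsDir p.2) :
    IsDir (ofBoundary b p).d := by
  cases b
  · simpa [ofBoundary] using h.neg
  · simpa [ofBoundary] using h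

/-- A blocking vertex carries exactly one boundary edge, so any contact forbidden by `Apart` would
identify the two boundary edges. -/
theorem apart_of_fits {col : ℤ × ℤ → Bool} {x y : State} (hx : Fits col x) (hy : Fits col y)
    (hxd : IsDir x.d) (hyd : IsDir y.d) (hne : x.toBoundary ≠ y.toBoundary) : Apart x y := by
  have key : ∀ {x y : State}, Fits col x → Fits col y → IsDir x.d → IsDir y.d →
      x.s = y.s + y.d → x.toBoundary = y.toBoundary := by
    intro x y hx hy hxd hyd h
    have h1 : x.χ = !y.χ := by rw [← hx.self, h, hy.out]
    have h2 : y.s = x.s + -y.d := by rw [h]; abel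
    have h3 : -y.d = x.d := by
      by_contra hd
      have := hx.side _ hyd.neg hd
      rw [← h2, hy.self, h1] at this
      simp at this
    unfold toBoundary
    cases hχ : y.χ <;> simp [h1, hχ, ← h3, h]
  refine ⟨fun h => hne ?_, fun h => hne (key hx hy hxd hyd h),
    fun h => hne (key hy hx hyd hxd h).symm⟩
  have h1 : x.χ = y.χ := by rw [← hx.self, h, hy.self]
  have h3 : x.d = y.d := by
    by_contra hd
    have := hy.side _ hxd hd
    rw [← h, hx.out, h1] at this
    simp at this
  simp [toBoundary, h, h1, h3]

-- A vertex around which the curve turns has two boundary edges and cannot block; this fixes both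
-- labels and gives C. On a straight piece equal labels give A and different ones B.
open Classical in
theorem step_of_next {C : Set (ℤ × ℤ)} {p : (ℤ × ℤ) × (ℤ × ℤ)} (hp : p ∈ boundary C) {b b' : Bool}
    (hx : Fits (fun v => decide (v ∈ C)) (ofBoundary b p))
    (hy : Fits (fun v => decide (v ∈ C)) (ofBoundary b' (next C p))) :
    Step (ofBoundary b p) (ofBoundary b' (next C p)) := by
  obtain ⟨hd, h1, h2⟩ := hp
  have hdr := hd.rot
  rcases next_cases C p with ⟨h, he⟩ | ⟨h, h', he⟩ | ⟨h, h', he⟩ <;> rw [he] at hy ⊢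
  · cases b
    · cases b'
      · right; right
        simp [ofBoundary, stepC, τ]
      · exfalso
        have := hy.side p.2 hd (by simpa [ofBoundary] using hd.ne_rot)
        simp [ofBoundary, h2] at this
    · exfalso
      have := hx.side (rot p.2) hdr (by simpa [ofBoundary] using hd.ne_rot.symm)
      simp [ofBoundary, h] at this
  · cases b <;> cases b'
    · left
      simp [ofBoundary, stepA, τ, add_right_comm]
    · right; left
      simp [ofBoundary, stepB, τ]
      abel
    · right; left
      simp [ofBoundary, stepB, τ]
    · left
      simp [ofBoundary, stepA, τ]
  · cases b
    · exfalso
      have := hx.side (rot p.2) hdr (by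
        simp only [ofBoundary]
        intro h
        exact hd.ne_neg_rot (by rw [h]; simp))
      simp [ofBoundary, h'] at this
    · cases b'
      · exfalso
        have := hy.side (-p.2) hd.neg (by
          simp only [ofBoundary, Bool.false_eq_true, if_false, neg_neg]
          intro h
          exact hd.ne_neg_rot (by rw [← h, neg_neg]))
        simp [ofBoundary, h1] at this
      · right; right
        simp [ofBoundary, stepC, τ]

end State

theorem iterate_next_mem {C : Set (ℤ × ℤ)} {p : (ℤ × ℤ) × (ℤ × ℤ)} (hp : p ∈ boundary C) (i : ℕ) :
    (next C)^[i] p ∈ boundary C := by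
  induction i with
  | zero => exact hp
  | succ i ih => rw [Function.iterate_succ_apply']; exact next_mem ih

open Classical in
/-- A piece of boundary all of whose edges are blocked is a realised piece of contour. -/
theorem extends_of_boundary {C : Set (ℤ × ℤ)} {U : Clocks} {p : (ℤ × ℤ) × (ℤ × ℤ)} {n : ℕ}
    (hp : p ∈ boundary C)
    (hne : ∀ i j, i < j → j ≤ n → (next C)^[i] p ≠ (next C)^[j] p)
    (h : ∀ i ≤ n, ∃ b, State.Fits (fun v => decide (v ∈ C)) (.ofBoundary b ((next C)^[i] p)) ∧
      State.Blocks U (.ofBoundary b ((next C)^[i] p))) :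
    ∃ b, State.Extends (.ofBoundary b p) n [] U := by
  have hmem := iterate_next_mem hp
  choose! b hb using h
  set x : ℕ → State := fun i => .ofBoundary (b i) ((next C)^[i] p) with hx
  have hdir : ∀ i, IsDir (x i).d := fun i => State.isDir_ofBoundary (hmem i).1
  suffices H : ∀ m ≤ n, ∃ l' : List State, l'.length = m ∧ (∃ l'', l' ++ [x 0] = x m :: l'') ∧
      (∀ y ∈ l' ++ [x 0], ∃ j ≤ m, y = x j) ∧
      (l' ++ [x 0]).IsChain (fun y x => State.Step x y) ∧ (l' ++ [x 0]).Pairwise State.Apart by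
    obtain ⟨l', h1, -, h2, h3, h4⟩ := H n le_rfl
    refine ⟨b 0, l', h1, ⟨?_, h3, h4, fun v => decide (v ∈ C), ?_⟩, ?_⟩
    · intro y hy
      obtain ⟨j, -, rfl⟩ := h2 y hy
      exact hdir j
    · intro y hy
      obtain ⟨j, hj, rfl⟩ := h2 y hy
      exact (hb j hj).1
    · intro y hy
      obtain ⟨j, hj, rfl⟩ := h2 y (by simp at hy; simp [hy])
      exact (hb j hj).2
  intro m
  induction m with
  | zero => exact fun _ => ⟨[], by simp⟩
  | succ m ih =>
    intro hm
    obtain ⟨l', h1, ⟨l'', h0⟩, h2, h3, h4⟩ := ih (by omega)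
    refine ⟨x (m + 1) :: l', by simp [h1], ⟨_, rfl⟩, ?_, ?_, ?_⟩
    · intro y hy
      rcases List.mem_cons.1 hy with rfl | hy
      · exact ⟨m + 1, le_rfl, rfl⟩
      · obtain ⟨j, hj, rfl⟩ := h2 y hy
        exact ⟨j, by omega, rfl⟩
    · rw [List.cons_append, h0, List.isChain_cons_cons]
      refine ⟨?_, h0 ▸ h3⟩
      have h5 := (hb (m + 1) hm).1
      have h6 := (hb m (by omega)).1
      simp only [hx]
      rw [Function.iterate_succ_apply'] at h5 ⊢
      exact State.step_of_next (hmem m) h6 h5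
    · rw [List.cons_append, List.pairwise_cons]
      refine ⟨fun y hy => ?_, h4⟩
      obtain ⟨j, hj, rfl⟩ := h2 y hy
      refine State.apart_of_fits (hb (m + 1) hm).1 (hb j (by omega)).1 (hdir _) (hdir _) ?_
      simp only [hx, State.toBoundary_ofBoundary]
      exact (hne j (m + 1) (by omega) hm).symm

theorem iterate_next_sub_le {C : Set (ℤ × ℤ)} {p : (ℤ × ℤ) × (ℤ × ℤ)} (hp : p ∈ boundary C)
    (i : ℕ) : |((next C)^[i] p).1.1 - p.1.1| ≤ i ∧ |((next C)^[i] p).1.2 - p.1.2| ≤ i := by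
  induction i with
  | zero => simp
  | succ i ih =>
    rw [Function.iterate_succ_apply']
    have := next_fst_sub_le (C := C) (iterate_next_mem hp i).1
    simp only [abs_le] at ih this ⊢
    push_cast
    omega

/-- The boundary curve of a large region does not close up quickly. -/
theorem iterate_next_ne {C : Set (ℤ × ℤ)} {p : (ℤ × ℤ) × (ℤ × ℤ)} (hp : p ∈ boundary C)
    {N n : ℕ} (hn : n < 2 * N) (h1 : (N : ℤ) ≤ p.1.1) {m : ℕ}
    (h2 : ((next C)^[m] p).1.1 ≤ -N) (a : ℕ) :
    ∀ i j, i < j → j ≤ n →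
      (next C)^[i] ((next C)^[a] p) ≠ (next C)^[j] ((next C)^[a] p) := by
  intro i j hij hj heq
  rw [← Function.iterate_add_apply, ← Function.iterate_add_apply] at heq
  obtain ⟨k, rfl⟩ : ∃ k, j = k + i := ⟨j - i, by omega⟩
  have hk : ∀ r, (next C)^[r] p = (next C)^[k + r] p → p = (next C)^[k] p := by
    intro r
    induction r with
    | zero => exact fun h => h
    | succ r ih =>
      intro h
      apply ih
      rw [← add_assoc, Function.iterate_succ_apply', Function.iterate_succ_apply'] at h
      exact next_injOn C (iterate_next_mem hp _) (iterate_next_mem hp _) h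
  -- By injectivity a repetition makes `p` periodic with period at most `n`. But the orbit moves at
  -- most one unit horizontally per step and must cover a distance 2N > n.
  have hper : Function.IsPeriodicPt (next C) k p :=
    (hk (i + a) (by rw [heq, add_assoc])).symm
  rw [← hper.iterate_mod_apply] at h2
  have h3 := (iterate_next_sub_le hp (m % k)).1
  have h4 : m % k < k := Nat.mod_lt _ (by omega)
  rw [abs_le] at h3
  omega

/-! ### Independence over disjoint sets of coordinates. -/

/-- The σ-algebra of the coordinates in `F`. -/
abbrev coordAlgebra {ι : Type*} (X : Type*) [MeasurableSpace X] (F : Set ι) :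
    MeasurableSpace (ι → X) :=
  ⨆ i ∈ F, MeasurableSpace.comap (fun ω : ι → X => ω i) inferInstance

theorem measurable_coordAlgebra {ι X : Type*} [MeasurableSpace X] {F : Set ι} {i : ι}
    (hi : i ∈ F) : Measurable[coordAlgebra X F] fun ω : ι → X => ω i := by
  rw [measurable_iff_comap_le]
  exact le_iSup₂_of_le i hi le_rfl

theorem coordAlgebra_mono {ι X : Type*} [MeasurableSpace X] {F G : Set ι} (h : F ⊆ G) :
    coordAlgebra X F ≤ coordAlgebra X G :=
  biSup_mono h

/-- Events that depend on disjoint sets of coordinates are independent. -/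
theorem infinitePi_biInter_eq_prod {ι X β : Type*} [MeasurableSpace X] (ν : Measure X)
    [IsProbabilityMeasure ν] (T : Finset β) {F : β → Set ι} {A : β → Set (ι → X)}
    (hF : ∀ z ∈ T, ∀ w ∈ T, z ≠ w → Disjoint (F z) (F w))
    (hA : ∀ z ∈ T, MeasurableSet[coordAlgebra X (F z)] (A z)) :
    (Measure.infinitePi fun _ : ι => ν) {ω | ∀ z ∈ T, ω ∈ A z} =
      ∏ z ∈ T, (Measure.infinitePi fun _ : ι => ν) (A z) := by
  classical
  have hind : ProbabilityTheory.iIndepFun (fun i (ω : ι → X) => ω i)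
      (Measure.infinitePi fun _ : ι => ν) :=
    ProbabilityTheory.iIndepFun_infinitePi (X := fun _ u => u) fun _ => measurable_id
  rw [ProbabilityTheory.iIndepFun_iff_iIndep] at hind
  induction T using Finset.induction_on with
  | empty => simp
  | insert a T ha ih =>
    rw [Finset.prod_insert ha, ← ih (fun z hz w hw => hF z (by simp [hz]) w (by simp [hw]))
      fun z hz => hA z (by simp [hz])]
    have hset : {ω : ι → X | ∀ z ∈ insert a T, ω ∈ A z} = A a ∩ {ω | ∀ z ∈ T, ω ∈ A z} := by
      ext ω; simp
    rw [hset]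
    have hdisj : Disjoint (F a) (⋃ z ∈ T, F z) := by
      rw [Set.disjoint_iUnion₂_right]
      exact fun z hz => hF a (by simp) z (by simp [hz]) fun h => ha (h ▸ hz)
    have := ProbabilityTheory.indep_iSup_of_disjoint
      (fun i => (measurable_pi_apply i).comap_le) hind hdisj
    rw [ProbabilityTheory.Indep_iff] at this
    refine this _ _ (hA a (by simp)) ?_
    have : {ω : ι → X | ∀ z ∈ T, ω ∈ A z} = ⋂ z ∈ T, A z := by ext ω; simp
    rw [this]
    exact MeasurableSet.biInter T.countable_toSet fun z hz =>
      coordAlgebra_mono (Set.subset_biUnion_of_mem (u := F) hz) _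
        (hA z (Finset.mem_insert_of_mem (Finset.mem_coe.1 hz)))

/-! ### Bad blocks and their probability. -/

/-- `v` lies in the block `z` of side `L`. -/
def InBlock (L : ℕ) (z v : ℤ × ℤ) : Prop := v.1 / L = z.1 ∧ v.2 / L = z.2

/-- `v` lies in the block `z` or in one of the eight blocks around it. -/
def NearBlock (L : ℕ) (z v : ℤ × ℤ) : Prop := |v.1 / L - z.1| ≤ 1 ∧ |v.2 / L - z.2| ≤ 1

theorem NearBlock.of_close {L : ℕ} (hL : 0 < L) {z u v : ℤ × ℤ} (hu : InBlock L z u)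
    (h1 : |v.1 - u.1| ≤ L) (h2 : |v.2 - u.2| ≤ L) : NearBlock L z v := by
  have key : ∀ {a b c : ℤ}, b / L = c → |a - b| ≤ L → |a / L - c| ≤ 1 := by
    intro a b c hb hab
    have hL' : (0 : ℤ) < L := by exact_mod_cast hL
    have e1 : c * L ≤ b := (Int.le_ediv_iff_mul_le hL').1 hb.ge
    have e2 : b < (c + 1) * L := (Int.ediv_lt_iff_lt_mul hL').1 (by omega)
    rw [abs_le] at hab ⊢
    have e3 : c - 1 ≤ a / L := (Int.le_ediv_iff_mul_le hL').2 (by linarith)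
    have e4 : a / L < c + 2 := (Int.ediv_lt_iff_lt_mul hL').2 (by linarith)
    omega
  exact ⟨key hu.1 h1, key hu.2 h2⟩

/-- Distinct blocks of one residue class modulo 3 differ by at least 3 in some coordinate, so their
neighbourhoods are disjoint. -/
theorem NearBlock.eq_of_mod {L : ℕ} {z w v : ℤ × ℤ} (hz : NearBlock L z v) (hw : NearBlock L w v)
    (h1 : z.1 % 3 = w.1 % 3) (h2 : z.2 % 3 = w.2 % 3) : z = w := by
  obtain ⟨a1, a2⟩ := hz
  obtain ⟨b1, b2⟩ := hw
  rw [abs_le] at a1 a2 b1 b2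
  ext <;> omega

/-- The vertices of a block. -/
noncomputable def blockFinset (L : ℕ) (z : ℤ × ℤ) : Finset (ℤ × ℤ) :=
  Finset.Ico (z.1 * L) ((z.1 + 1) * L) ×ˢ Finset.Ico (z.2 * L) ((z.2 + 1) * L)

/-- The vertices near a block. -/
noncomputable def nearFinset (L : ℕ) (z : ℤ × ℤ) : Finset (ℤ × ℤ) :=
  Finset.Ico ((z.1 - 1) * L) ((z.1 + 2) * L) ×ˢ Finset.Ico ((z.2 - 1) * L) ((z.2 + 2) * L)

theorem card_blockFinset (L : ℕ) (z : ℤ × ℤ) : (blockFinset L z).card = L ^ 2 := by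
  rw [blockFinset, Finset.card_product, Int.card_Ico, Int.card_Ico]
  rw [show (z.1 + 1) * (L : ℤ) - z.1 * L = L by ring,
    show (z.2 + 1) * (L : ℤ) - z.2 * L = L by ring, Int.toNat_natCast]
  ring

theorem card_nearFinset (L : ℕ) (z : ℤ × ℤ) : (nearFinset L z).card = 9 * L ^ 2 := by
  rw [nearFinset, Finset.card_product, Int.card_Ico, Int.card_Ico]
  rw [show (z.1 + 2) * (L : ℤ) - (z.1 - 1) * L = ((3 * L : ℕ) : ℤ) by push_cast; ring,
    show (z.2 + 2) * (L : ℤ) - (z.2 - 1) * L = ((3 * L : ℕ) : ℤ) by push_cast; ring,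
    Int.toNat_natCast]
  ring

theorem InBlock.mem {L : ℕ} (hL : 0 < L) {z v : ℤ × ℤ} (h : InBlock L z v) :
    v ∈ blockFinset L z := by
  have hL' : (0 : ℤ) < L := by exact_mod_cast hL
  rw [blockFinset, Finset.mem_product, Finset.mem_Ico, Finset.mem_Ico,
    ← Int.le_ediv_iff_mul_le hL', ← Int.ediv_lt_iff_lt_mul hL', ← Int.le_ediv_iff_mul_le hL',
    ← Int.ediv_lt_iff_lt_mul hL']
  obtain ⟨h1, h2⟩ := h
  omega

theorem NearBlock.mem {L : ℕ} (hL : 0 < L) {z v : ℤ × ℤ} (h : NearBlock L z v) :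
    v ∈ nearFinset L z := by
  have hL' : (0 : ℤ) < L := by exact_mod_cast hL
  rw [nearFinset, Finset.mem_product, Finset.mem_Ico, Finset.mem_Ico,
    ← Int.le_ediv_iff_mul_le hL', ← Int.ediv_lt_iff_lt_mul hL', ← Int.le_ediv_iff_mul_le hL',
    ← Int.ediv_lt_iff_lt_mul hL']
  obtain ⟨h1, h2⟩ := h
  rw [abs_le] at h1 h2
  omega

/-- The edges with both end-vertices near a block. -/
def nearEdges (L : ℕ) (z : ℤ × ℤ) : Set Edge := {e | ∀ v ∈ e.1, NearBlock L z v}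

/-- The clocks are bad in the block `z`: a long piece of contour starting in `z` is blocked, or
some clock nearby rings after time `t`. -/
def badClocks (n L : ℕ) (t : ℝ) (z : ℤ × ℤ) : Set Clocks :=
  {U | (∃ p : (ℤ × ℤ) × (ℤ × ℤ), InBlock L z p.1 ∧ IsDir p.2 ∧
    ∃ b, State.Extends (.ofBoundary b p) n [] U) ∨ ∃ e ∈ nearEdges L z, t < U e}

/-- Some constraint near the block `z` is not `3`. -/
def badConstraints (L : ℕ) (z : ℤ × ℤ) : Set Constraints := {κ | ∃ v, NearBlock L z v ∧ κ v ≠ 3}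

namespace State

instance : Countable State :=
  Function.Injective.countable (f := fun x : State => (x.s, x.d, x.χ)) fun x y h => by
    cases x; cases y; simpa using h

theorem sub_le_of_step {x y : State} (hx : IsDir x.d) (h : Step x y) :
    |y.s.1 - x.s.1| ≤ 1 ∧ |y.s.2 - x.s.2| ≤ 1 := by
  unfold Step stepA stepB stepC τ at h
  rcases isDir_iff.1 hx with hd | hd | hd | hd <;> rw [hd] at h <;>
    rcases h with rfl | rfl | rfl <;> cases x.χ <;> simp [rot]

theorem sub_le_of_cons {l : List State} {i₀ : State} (h : Cons (l ++ [i₀])) :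
    ∀ x ∈ l ++ [i₀], |x.s.1 - i₀.s.1| ≤ l.length ∧ |x.s.2 - i₀.s.2| ≤ l.length := by
  induction l with
  | nil => simp
  | cons a l ih =>
    intro x hx
    have ih' := ih h.tail
    rw [List.cons_append] at hx
    rcases List.mem_cons.1 hx with rfl | hx
    · have hc := h.chain
      rw [List.cons_append, append_eq_headD_cons, List.isChain_cons_cons] at hc
      have h1 := sub_le_of_step (h.tail.dir _ (headD_mem l i₀)) hc.1
      have h2 := ih' _ (headD_mem l i₀)
      simp only [abs_le, List.length_cons, Nat.cast_add, Nat.cast_one] at h1 h2 ⊢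
      omega
    · have := ih' x hx
      simp only [List.length_cons, Nat.cast_add, Nat.cast_one]
      omega

theorem ofBoundary_sub_le {b : Bool} {p : (ℤ × ℤ) × (ℤ × ℤ)} (hp : IsDir p.2) :
    |(ofBoundary b p).s.1 - p.1.1| ≤ 1 ∧ |(ofBoundary b p).s.2 - p.1.2| ≤ 1 := by
  cases b <;> rcases isDir_iff.1 hp with h | h | h | h <;> simp [ofBoundary, h]

end State

/-- A contour of n further states moves at most n units; one more unit is needed to reach the first
blocking vertex and one for the edges at a state, whence `n + 2 ≤ L`. -/
theorem measurableSet_badClocks {n L : ℕ} (hL : n + 2 ≤ L) (t : ℝ) (z : ℤ × ℤ) :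
    MeasurableSet[coordAlgebra unitInterval (nearEdges L z)] (badClocks n L t z) := by
  have hEq : badClocks n L t z =
      (⋃ p : (ℤ × ℤ) × (ℤ × ℤ), ⋃ _ : InBlock L z p.1 ∧ IsDir p.2, ⋃ b : Bool, ⋃ l : List State,
        ⋃ _ : l.length = n ∧ State.Cons (l ++ [.ofBoundary b p]), ⋂ x ∈ {x | x ∈ l},
          ⋂ δ : ℤ × ℤ, ⋂ _ : IsDir δ ∧ δ ≠ x.d, {U : Clocks | U (edgeAt x.s δ) < U x.edge}) ∪
      ⋃ e ∈ nearEdges L z, {U : Clocks | t < U e} := by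
    ext U
    simp only [badClocks, State.Extends, State.Blocks, Set.mem_ofPred_eq, Set.mem_union,
      Set.mem_iUnion, Set.mem_iInter, exists_prop, List.nil_append, List.append_nil, and_imp,
      and_assoc]
  have hmem : ∀ {p : (ℤ × ℤ) × (ℤ × ℤ)} {b : Bool} {l : List State} {x : State} {δ : ℤ × ℤ},
      InBlock L z p.1 → IsDir p.2 → l.length = n → State.Cons (l ++ [.ofBoundary b p]) →
      x ∈ l → IsDir δ → edgeAt x.s δ ∈ nearEdges L z := by
    intro p b l x δ hp hd hl hc hx hδ v hv
    have h1 := State.sub_le_of_cons hc x (by simp [hx])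
    have h2 := State.ofBoundary_sub_le (b := b) hd
    have h3 : |v.1 - x.s.1| ≤ 1 ∧ |v.2 - x.s.2| ≤ 1 := by
      rw [edgeAt_val hδ, Sym2.mem_iff] at hv
      rcases hv with rfl | rfl
      · simp
      · rcases isDir_iff.1 hδ with h | h | h | h <;> simp [h]
    rw [hl] at h1
    refine NearBlock.of_close (by omega) hp ?_ ?_ <;> rw [abs_le] at * <;>
      simp only [abs_le] at * <;> omega
  rw [hEq]
  refine .union (.iUnion fun p => .iUnion fun hp => .iUnion fun b => .iUnion fun l =>
    .iUnion fun hl => .biInter (Set.to_countable _) fun x hx => .iInter fun δ => .iInter fun hδ =>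
      ?_) (.biUnion (Set.to_countable _) fun e he => ?_)
  · have hx' : IsDir x.d := hl.2.dir x (by simp only [Set.mem_ofPred_eq] at hx; simp [hx])
    exact @measurableSet_lt _ _ _ _ _ (coordAlgebra unitInterval (nearEdges L z)) _ _ _ _ _
      (measurable_coordAlgebra (hmem hp.1 hp.2 hl.1 hl.2 hx hδ.1))
      (measurable_coordAlgebra (hmem hp.1 hp.2 hl.1 hl.2 hx hx'))
  · exact @measurableSet_lt _ _ _ _ _ (coordAlgebra unitInterval (nearEdges L z)) _ _ _ _ _
      (@measurable_const _ _ _ (coordAlgebra unitInterval (nearEdges L z)) _)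
      (measurable_subtype_coe.comp (measurable_coordAlgebra he))

theorem measurableSet_badConstraints (L : ℕ) (z : ℤ × ℤ) :
    MeasurableSet[coordAlgebra (Fin 4) {v | NearBlock L z v}] (badConstraints L z) := by
  have hEq : badConstraints L z =
      ⋃ v ∈ {v | NearBlock L z v}, (fun κ : Constraints => κ v) ⁻¹' {3}ᶜ := by
    ext κ; simp [badConstraints]
  rw [hEq]
  exact .biUnion (Set.to_countable _) fun v hv =>
    measurable_coordAlgebra (X := Fin 4) hv (measurableSet_singleton _).compl

/-- The four unit vectors. -/
def dirs : Finset (ℤ × ℤ) := {(1, 0), (-1, 0), (0, 1), (0, -1)}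

theorem IsDir.mem_dirs {δ : ℤ × ℤ} (h : IsDir δ) : δ ∈ dirs := by
  rcases isDir_iff.1 h with h | h | h | h <;> simp [dirs, h]

theorem card_dirs : dirs.card = 4 := by decide

theorem volume_gt_le (t : ℝ) : volume {u : unitInterval | t < u} ≤ ENNReal.ofReal (1 - t) := by
  rw [unitInterval.volume_apply, ← Real.volume_Ioc]
  refine measure_mono ?_
  rintro _ ⟨u, hu, rfl⟩
  exact ⟨hu, u.2.2⟩

theorem infinitePi_eval {ι X : Type*} [MeasurableSpace X] (ν : Measure X) [IsProbabilityMeasure ν]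
    (i : ι) {A : Set X} (hA : MeasurableSet A) :
    (Measure.infinitePi fun _ : ι => ν) {ω | ω i ∈ A} = ν A := by
  conv_rhs => rw [← Measure.infinitePi_map_eval (fun _ : ι => ν) i]
  rw [Measure.map_apply (measurable_pi_apply i) hA]
  rfl

/-- Union bound: L² vertices, 4 directions and 2 blocking ends for the start of a contour; 9L²
vertices and 4 directions for a late clock. -/
theorem clockMeasure_badClocks_le {n L : ℕ} (hL : 0 < L) (t : ℝ) (z : ℤ × ℤ) :
    clockMeasure Edge (badClocks n L t z) ≤
      ((L ^ 2 * (4 * 2) : ℕ) : ENNReal) * ENNReal.ofReal (1000 * (99 / 100) ^ n) +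
        ((9 * L ^ 2 * 4 : ℕ) : ENNReal) * ENNReal.ofReal (1 - t) := by
  have hsub : badClocks n L t z ⊆
      (⋃ i ∈ blockFinset L z ×ˢ dirs ×ˢ (Finset.univ : Finset Bool),
        {U | State.Extends (.ofBoundary i.2.2 (i.1, i.2.1)) n [] U}) ∪
      ⋃ i ∈ nearFinset L z ×ˢ dirs, {U : Clocks | t < U (edgeAt i.1 i.2)} := by
    rintro U (⟨p, hp, hd, b, hb⟩ | ⟨e, he, ht⟩)
    · exact .inl (Set.mem_biUnion (x := (p.1, p.2, b)) (by simp [hp.mem hL, hd.mem_dirs]) hb)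
    · obtain ⟨v, hv⟩ : ∃ v, v ∈ e.1 := ⟨e.1.out.1, Sym2.out_fst_mem _⟩
      have hn := he v hv
      obtain ⟨δ, hδ, rfl⟩ := exists_edgeAt e hv
      exact .inr (Set.mem_biUnion (x := (v, δ)) (by simp [hn.mem hL, hδ.mem_dirs]) ht)
  refine (measure_mono hsub).trans ((measure_union_le _ _).trans (add_le_add ?_ ?_))
  · refine (measure_biUnion_finset_le _ _).trans
      ((Finset.sum_le_card_nsmul _ _ _ fun i _ => State.clockMeasure_extends_nil_le _ n).trans ?_)
    rw [Finset.card_product, Finset.card_product, card_blockFinset, card_dirs, Finset.card_univ,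
      Fintype.card_bool, nsmul_eq_mul]
  · refine (measure_biUnion_finset_le _ _).trans
      ((Finset.sum_le_card_nsmul _ _ (ENNReal.ofReal (1 - t)) fun i _ => ?_).trans ?_)
    · exact (infinitePi_eval volume (edgeAt i.1 i.2)
        (measurableSet_lt measurable_const measurable_subtype_coe)).trans_le (volume_gt_le t)
    · rw [Finset.card_product, card_nearFinset, card_dirs, nsmul_eq_mul]

theorem measure_badConstraints_le (ρ : PMF (Fin 4)) {L : ℕ} (hL : 0 < L) (z : ℤ × ℤ) :
    (Measure.infinitePi fun _ : ℤ × ℤ => ρ.toMeasure) (badConstraints L z) ≤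
      ((9 * L ^ 2 : ℕ) : ENNReal) * ENNReal.ofReal (1 - (ρ 3).toReal) := by
  have hsub : badConstraints L z ⊆ ⋃ v ∈ nearFinset L z, {κ : Constraints | κ v ∈ ({3} : Set _)ᶜ} := by
    rintro κ ⟨v, hv, hκ⟩
    exact Set.mem_biUnion (x := v) (hv.mem hL) hκ
  refine (measure_mono hsub).trans ((measure_biUnion_finset_le _ _).trans
      ((Finset.sum_le_card_nsmul _ _ (ENNReal.ofReal (1 - (ρ 3).toReal)) fun v _ => ?_).trans ?_))
  · rw [infinitePi_eval ρ.toMeasure v (measurableSet_singleton _).compl,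
      prob_compl_eq_one_sub (measurableSet_singleton _),
      PMF.toMeasure_apply_singleton _ _ (measurableSet_singleton _),
      ENNReal.ofReal_sub _ ENNReal.toReal_nonneg, ENNReal.ofReal_toReal (ρ.apply_ne_top 3),
      ENNReal.ofReal_one]
  · rw [card_nearFinset, nsmul_eq_mul]

/-- The block `z` is bad, on account of its clocks or of its constraints. -/
def badBlock (n L : ℕ) (t : ℝ) (z : ℤ × ℤ) : Set (Clocks × Constraints) :=
  {x | x.1 ∈ badClocks n L t z ∨ x.2 ∈ badConstraints L z}

theorem exists_residue_class (s : Finset (ℤ × ℤ)) :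
    ∃ T ⊆ s, s.card ≤ 9 * T.card ∧ ∀ z ∈ T, ∀ w ∈ T, z.1 % 3 = w.1 % 3 ∧ z.2 % 3 = w.2 % 3 := by
  classical
  rcases s.eq_empty_or_nonempty with rfl | hs
  · exact ⟨∅, by simp⟩
  have hpos := hs.card_pos
  -- Pigeonhole over nine classes: more than (card - 1)/9 elements means at least card/9.
  obtain ⟨y, -, hy⟩ := Finset.exists_lt_card_fiber_of_mul_lt_card_of_maps_to (s := s)
    (t := Finset.Ico (0 : ℤ) 3 ×ˢ Finset.Ico (0 : ℤ) 3) (f := fun z => (z.1 % 3, z.2 % 3))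
    (n := (s.card - 1) / 9) (fun z _ => by simp; omega) (by simp; omega)
  refine ⟨{z ∈ s | (z.1 % 3, z.2 % 3) = y}, Finset.filter_subset _ _, ?_, ?_⟩
  · omega
  · intro z hz w hw
    have h1 := (Finset.mem_filter.1 hz).2
    have h2 := (Finset.mem_filter.1 hw).2
    rw [← h2, Prod.mk.injEq] at h1
    exact h1

/-- Within a residue class the clock events are independent, and so are the constraint events.
Summing over the set `S` of blocks with bad clocks gives `(ε + ε) ^ T.card`; the ninth power in `hε`
compensates for keeping only a ninth of the blocks. -/
theorem environment_badBlock_le {ρ : PMF (Fin 4)} {n L : ℕ} (hL : n + 2 ≤ L) {t : ℝ}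
    {ε q : ENNReal} (h1 : ∀ z, clockMeasure Edge (badClocks n L t z) ≤ ε)
    (h2 : ∀ z, (Measure.infinitePi fun _ : ℤ × ℤ => ρ.toMeasure) (badConstraints L z) ≤ ε)
    (hε : ε + ε ≤ q ^ 9) (hq : q ≤ 1) (l : List (ℤ × ℤ)) (hl : l.Nodup) :
    environment ρ {x | ∀ z ∈ l, x ∈ badBlock n L t z} ≤ q ^ l.length := by
  classical
  obtain ⟨T, hT, hcard, hmod⟩ := exists_residue_class l.toFinset
  rw [List.toFinset_card_of_nodup hl] at hcard
  have hsub : {x | ∀ z ∈ l, x ∈ badBlock n L t z} ⊆ ⋃ S ∈ T.powerset,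
      {U : Clocks | ∀ z ∈ S, U ∈ badClocks n L t z} ×ˢ
        {κ : Constraints | ∀ z ∈ T \ S, κ ∈ badConstraints L z} := by
    intro x hx
    refine Set.mem_biUnion (x := T.filter fun z => x.1 ∈ badClocks n L t z)
      (Finset.mem_coe.2 (Finset.mem_powerset.2 (Finset.filter_subset _ _))) ⟨?_, ?_⟩
    · exact fun z hz => (Finset.mem_filter.1 hz).2
    · intro z hz
      simp only [Finset.mem_sdiff, Finset.mem_filter, not_and] at hz
      exact (hx z (List.mem_toFinset.1 (hT hz.1))).resolve_left (hz.2 hz.1)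
  have hterm : ∀ S ∈ T.powerset, environment ρ ({U : Clocks | ∀ z ∈ S, U ∈ badClocks n L t z} ×ˢ
      {κ : Constraints | ∀ z ∈ T \ S, κ ∈ badConstraints L z}) ≤
        ε ^ S.card * ε ^ (T.card - S.card) := by
    intro S hS
    rw [Finset.mem_powerset] at hS
    rw [environment, Measure.prod_prod]
    refine mul_le_mul' ?_ ?_
    · rw [infinitePi_biInter_eq_prod _ S (F := nearEdges L) ?_
        fun z _ => measurableSet_badClocks hL t z]
      · exact Finset.prod_le_pow_card _ _ _ fun z _ => h1 z
      · intro z hz w hw hzw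
        rw [Set.disjoint_left]
        intro e he he'
        have hm := hmod z (hS hz) w (hS hw)
        exact hzw ((he _ (Sym2.out_fst_mem _)).eq_of_mod (he' _ (Sym2.out_fst_mem _)) hm.1 hm.2)
    · rw [infinitePi_biInter_eq_prod _ (T \ S) (F := fun z => {v | NearBlock L z v}) ?_
        fun z _ => measurableSet_badConstraints L z, ← Finset.card_sdiff_of_subset hS]
      · exact Finset.prod_le_pow_card _ _ _ fun z _ => h2 z
      · intro z hz w hw hzw
        rw [Set.disjoint_left]
        intro v hv hv'
        have hm := hmod z (Finset.sdiff_subset hz) w (Finset.sdiff_subset hw)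
        exact hzw (NearBlock.eq_of_mod hv hv' hm.1 hm.2)
  calc _ ≤ _ := measure_mono hsub
    _ ≤ _ := measure_biUnion_finset_le _ _
    _ ≤ _ := Finset.sum_le_sum hterm
    _ = (ε + ε) ^ T.card := Finset.sum_pow_mul_eq_add_pow _ _ _
    _ ≤ (q ^ 9) ^ T.card := pow_le_pow_left' hε _
    _ = q ^ (9 * T.card) := (pow_mul _ _ _).symm
    _ ≤ q ^ l.length := pow_le_pow_right_of_le_one' hq hcard

/-- For a suitable block size, blocks are bad with small probability, uniformly for parameters
close to `1`. -/
theorem exists_badBlock_bound {ε : ℝ} (hε : 0 < ε) :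
    ∃ n : ℕ, ∃ η > 0, ∀ (ρ : PMF (Fin 4)) (t : ℝ), 1 - η < (ρ 3).toReal → 1 - η < t →
      ∀ z, clockMeasure Edge (badClocks n (n + 2) t z) ≤ ENNReal.ofReal ε ∧
        (Measure.infinitePi fun _ : ℤ × ℤ => ρ.toMeasure) (badConstraints (n + 2) z) ≤
          ENNReal.ofReal ε := by
  -- 8000 is the prefactor 1000 times 8 starts per vertex, and n + 2 is the block side.
  obtain ⟨n, hn⟩ : ∃ n : ℕ, 8000 * ((n + 2 : ℝ) ^ 2 * (99 / 100) ^ n) ≤ ε / 2 := by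
    have h1 := tendsto_pow_const_mul_const_pow_of_abs_lt_one 2 (r := 99 / 100)
      (by rw [abs_of_pos] <;> norm_num)
    have h2 := (h1.comp (Filter.tendsto_add_atTop_nat 2)).eventually
      (gt_mem_nhds (show (0 : ℝ) < (99 / 100) ^ 2 * (ε / 2 / 8000) by positivity))
    obtain ⟨n, hn⟩ := h2.exists
    refine ⟨n, ?_⟩
    simp only [Function.comp_apply, pow_add, Nat.cast_add, Nat.cast_ofNat] at hn
    nlinarith
  -- With `n` fixed, this η makes the late clocks contribute at most ε/2; the constraints need less.
  refine ⟨n, ε / (72 * (n + 2 : ℝ) ^ 2), by positivity, fun ρ t hρ ht z => ?_⟩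
  have hη : 36 * (n + 2 : ℝ) ^ 2 * (ε / (72 * (n + 2 : ℝ) ^ 2)) = ε / 2 := by
    field_simp; ring
  constructor
  · refine (clockMeasure_badClocks_le (by omega) t z).trans ?_
    rw [← ENNReal.ofReal_natCast, ← ENNReal.ofReal_natCast, ← ENNReal.ofReal_mul (by positivity),
      ← ENNReal.ofReal_mul (by positivity)]
    have h3 : ((9 * (n + 2) ^ 2 * 4 : ℕ) : ℝ) * (1 - t) ≤ ε / 2 := by
      rw [← hη]
      push_cast
      rw [show (9 * (n + 2 : ℝ) ^ 2 * 4) = 36 * (n + 2 : ℝ) ^ 2 by ring]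
      gcongr
      linarith
    calc _ ≤ ENNReal.ofReal (ε / 2) + ENNReal.ofReal (ε / 2) := by
          refine add_le_add (ENNReal.ofReal_le_ofReal ?_) (ENNReal.ofReal_le_ofReal h3)
          push_cast
          linarith
      _ = ENNReal.ofReal ε := by
          rw [← ENNReal.ofReal_add (by positivity) (by positivity), add_halves]
  · refine (measure_badConstraints_le ρ (by omega) z).trans ?_
    rw [← ENNReal.ofReal_natCast, ← ENNReal.ofReal_mul (by positivity)]
    refine ENNReal.ofReal_le_ofReal ?_
    have h3 : ((9 * (n + 2) ^ 2 : ℕ) : ℝ) * (1 - (ρ 3).toReal) ≤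
        9 * (n + 2 : ℝ) ^ 2 * (ε / (72 * (n + 2 : ℝ) ^ 2)) := by
      push_cast
      gcongr
      linarith
    linarith

/-! ### From finite clusters to paths of bad blocks. -/

theorem openGraph_adj_add_iff {ω : Config} {v δ : ℤ × ℤ} (h : IsDir δ) :
    (openGraph ω).Adj v (v + δ) ↔ ω (edgeAt v δ) = true := by
  rw [edgeAt, dif_pos h]
  exact ⟨fun ⟨_, hω⟩ => hω, fun hω => ⟨adj_add_iff.2 h, hω⟩⟩

theorem edgeAt_add_neg {v δ : ℤ × ℤ} (h : IsDir δ) : edgeAt (v + δ) (-δ) = edgeAt v δ :=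
  ((edgeAt_eq_iff h h.neg).2 (.inr ⟨rfl, rfl⟩)).symm

open Classical in
/-- A boundary edge of a union of open clusters is blocked at one of its end-vertices, provided
that its clock has rung and that both constraints are `3`. -/
theorem fits_and_blocks {t : ℝ} {x : Clocks × Constraints} (hwf : WellFounded (Earlier x.1))
    {C : Set (ℤ × ℤ)} (hC : ∀ v w, (openGraph (config t x)).Adj v w → (v ∈ C ↔ w ∈ C))
    {p : (ℤ × ℤ) × (ℤ × ℤ)} (hp : p ∈ boundary C) (ht : (x.1 (edgeAt p.1 p.2) : ℝ) ≤ t)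
    (h1 : x.2 p.1 = 3) (h2 : x.2 (p.1 + p.2) = 3) :
    ∃ b, State.Fits (fun v => decide (v ∈ C)) (.ofBoundary b p) ∧
      State.Blocks x.1 (.ofBoundary b p) := by
  obtain ⟨c, δ⟩ := p
  obtain ⟨hd, hc, hcδ⟩ := hp
  simp only at hd hc hcδ ht h1 h2
  have hclosed : config t x (edgeAt c δ) = false := by
    rw [← Bool.not_eq_true, ← openGraph_adj_add_iff hd]
    exact fun h => hcδ ((hC _ _ h).1 hc)
  obtain ⟨v, hv, hb⟩ := exists_blocking hwf hclosed ht (by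
    intro v hv
    rw [edgeAt_val hd, Sym2.mem_iff] at hv
    rcases hv with rfl | rfl <;> assumption)
  -- The other edges at `v` are open, so they join vertices on the same side of `C`; this yields the
  -- uniqueness in `Fits`.
  have key : ∀ δ', IsDir δ' → edgeAt v δ' ≠ edgeAt c δ →
      (v ∈ C ↔ v + δ' ∈ C) ∧ x.1 (edgeAt v δ') < x.1 (edgeAt c δ) := by
    intro δ' hδ' hne
    obtain ⟨ho, hlt⟩ := hb (edgeAt v δ') (by rw [edgeAt_val hδ']; simp) hne
    exact ⟨hC _ _ ((openGraph_adj_add_iff hδ').2 ho), hlt⟩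
  rw [edgeAt_val hd, Sym2.mem_iff] at hv
  rcases hv with rfl | rfl
  · have hne : ∀ δ', IsDir δ' → δ' ≠ δ → edgeAt v δ' ≠ edgeAt v δ := by
      intro δ' hδ' hne h
      rcases (edgeAt_eq_iff hδ' hd).1 h with h | h
      · exact hne h.2
      · exact hδ'.ne_zero (by simpa using h.1)
    refine ⟨true, ⟨by simpa [State.ofBoundary] using hc, by simpa [State.ofBoundary] using hcδ,
      fun δ' h h' => ?_⟩, fun δ' h h' => ?_⟩
    · simpa [State.ofBoundary] using ((key δ' h (hne δ' h h')).1).1 hc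
    · exact (key δ' h (hne δ' h h')).2
  · have hne : ∀ δ', IsDir δ' → δ' ≠ -δ → edgeAt (c + δ) δ' ≠ edgeAt c δ := by
      intro δ' hδ' hne h
      rcases (edgeAt_eq_iff hδ' hd).1 h with h | h
      · exact hd.ne_zero (by simpa using h.1)
      · exact hne (by rw [h.2, neg_neg])
    refine ⟨false, ⟨by simpa [State.ofBoundary] using hcδ, by simpa [State.ofBoundary] using hc,
      fun δ' h h' => ?_⟩, fun δ' h h' => ?_⟩
    · simpa [State.ofBoundary] using mt ((key δ' h (hne δ' h h')).1).2 hcδ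
    · have := (key δ' h (hne δ' h h')).2
      rw [← edgeAt_add_neg hd] at this
      exact this

/-- The `3 × 3` square around `z`. -/
noncomputable def square (z : ℤ × ℤ) : Finset (ℤ × ℤ) :=
  Finset.Icc (z.1 - 1) (z.1 + 1) ×ˢ Finset.Icc (z.2 - 1) (z.2 + 1)

theorem mem_square {z w : ℤ × ℤ} : w ∈ square z ↔ |w.1 - z.1| ≤ 1 ∧ |w.2 - z.2| ≤ 1 := by
  simp only [square, Finset.mem_product, Finset.mem_Icc, abs_le]
  omega

theorem card_square (z : ℤ × ℤ) : (square z).card = 9 := by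
  rw [square, Finset.card_product, Int.card_Icc, Int.card_Icc]
  have h : ∀ a : ℤ, (a + 1 + 1 - (a - 1)).toNat = 3 := fun a => by omega
  rw [h, h]

/-- Adjacency of different blocks in `B` that share a side or a corner. -/
def blockGraph (B : Set (ℤ × ℤ)) : SimpleGraph (ℤ × ℤ) where
  Adj z w := z ≠ w ∧ z ∈ B ∧ w ∈ B ∧ z ∈ square w
  symm := ⟨fun z w ⟨h, hz, hw, hs⟩ => ⟨h.symm, hw, hz, by
    rw [mem_square] at hs ⊢; rwa [abs_sub_comm w.1, abs_sub_comm w.2]⟩⟩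
  loopless := ⟨fun _ h => h.1 rfl⟩

theorem mem_of_mem_support {B : Set (ℤ × ℤ)} {u v : ℤ × ℤ} (P : (blockGraph B).Walk u v)
    (hv : v ∈ B) : ∀ w ∈ P.support, w ∈ B := by
  induction P with
  | nil => simpa using hv
  | cons h P ih =>
    intro w hw
    rw [SimpleGraph.Walk.support_cons, List.mem_cons] at hw
    rcases hw with rfl | hw
    exacts [h.2.1, ih hv w hw]

theorem fst_sub_le_length {B : Set (ℤ × ℤ)} {u v : ℤ × ℤ} (P : (blockGraph B).Walk u v) :
    v.1 - u.1 ≤ P.length := by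
  induction P with
  | nil => simp
  | cons h P ih =>
    have := (mem_square.1 h.2.2.2).1
    rw [abs_le] at this
    rw [SimpleGraph.Walk.length_cons]
    push_cast
    linarith

/-- A walk in `B` from `(a, 0)` to the left half-plane contains a self-avoiding path of `a`
steps from `(a, 0)`. -/
theorem exists_path_of_walk {B : Set (ℤ × ℤ)} {f : ℕ → ℤ × ℤ} {a j : ℕ}
    (hf : ∀ i, f (i + 1) ∈ square (f i)) (hB : ∀ i, f i ∈ B) (h0 : f 0 = ((a : ℤ), 0))
    (hj : (f j).1 < 0) :
    ∃ l : List (ℤ × ℤ), l.length = a ∧ (l ++ [((a : ℤ), 0)]).IsChain (fun z w => z ∈ square w) ∧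
      (l ++ [((a : ℤ), 0)]).Nodup ∧ ∀ z ∈ l ++ [((a : ℤ), 0)], z ∈ B := by
  have hreach : ∀ i, (blockGraph B).Reachable (f i) (f 0) := by
    intro i
    induction i with
    | zero => rfl
    | succ i ih =>
      by_cases h : f (i + 1) = f i
      · rw [h]; exact ih
      · exact SimpleGraph.Reachable.trans
          (SimpleGraph.Adj.reachable ⟨h, hB _, hB _, hf i⟩) ih
  have hr := hreach j
  rw [h0] at hr
  obtain ⟨P, hP⟩ := hr.exists_isPath
  -- The first coordinate rises from below 0 to `a` by at most one per step. Only the last `a + 1`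
  -- vertices, ending at the start `(a, 0)`, are kept.
  have hlen : a + 1 ≤ P.length := by
    have := fst_sub_le_length P
    simp only at this
    omega
  have hsl := P.length_support
  have hne : P.support.drop (P.support.length - (a + 1)) ≠ [] := by
    rw [Ne, List.drop_eq_nil_iff]; omega
  have hdec : (P.support.drop (P.support.length - (a + 1))).dropLast ++ [((a : ℤ), 0)] =
      P.support.drop (P.support.length - (a + 1)) := by
    conv_rhs => rw [← List.dropLast_append_getLast hne]
    rw [List.getLast_drop, SimpleGraph.Walk.getLast_support]
  refine ⟨(P.support.drop (P.support.length - (a + 1))).dropLast, ?_, ?_⟩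
  · rw [List.length_dropLast, List.length_drop]; omega
  · rw [hdec]
    refine ⟨?_, ?_, ?_⟩
    · exact (P.isChain_adj_support.imp fun _ _ h => h.2.2.2).drop _
    · exact (List.drop_sublist _ _).nodup hP.support_nodup
    · exact fun z hz => mem_of_mem_support P (h0 ▸ hB 0) z (List.mem_of_mem_drop hz)

/-- The union of the open clusters of the vertices `(a, 0)`, `|a| ≤ N`. -/
def segmentCluster (N : ℕ) (ω : Config) : Set (ℤ × ℤ) :=
  {w | ∃ a : ℤ, |a| ≤ N ∧ w ∈ cluster ω (a, 0)}

/-- If the cluster of a segment is finite, there is a long path of bad blocks. -/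
theorem exists_badBlock_path {n L : ℕ} (hL : n + 2 ≤ L) {t : ℝ} {x : Clocks × Constraints}
    (hwf : WellFounded (Earlier x.1)) (hfin : (segmentCluster (n + 1) (config t x)).Finite) :
    ∃ a : ℕ, ∃ l : List (ℤ × ℤ), l.length = a ∧
      (l ++ [((a : ℤ), 0)]).IsChain (fun z w => z ∈ square w) ∧
      (l ++ [((a : ℤ), 0)]).Nodup ∧ ∀ z ∈ l ++ [((a : ℤ), 0)], x ∈ badBlock n L t z := by
  classical
  set C := segmentCluster (n + 1) (config t x) with hCdef
  have hC : ∀ v w, (openGraph (config t x)).Adj v w → (v ∈ C ↔ w ∈ C) := by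
    intro v w h
    refine exists_congr fun a => and_congr_right fun _ => ?_
    exact ⟨fun h' => h'.trans h.reachable, fun h' => h'.trans h.symm.reachable⟩
  obtain ⟨p, hp, hp2, hp1, j, hj⟩ := exists_contour hfin (N := n + 1) (by omega)
    fun a ha => ⟨a, ha, SimpleGraph.Reachable.refl _⟩
  have hL0 : (0 : ℤ) < L := by omega
  push_cast at hp1 hj
  obtain ⟨a, ha⟩ : ∃ a : ℕ, p.1.1 / L = a :=
    Int.eq_ofNat_of_zero_le (Int.ediv_nonneg (by omega) hL0.le)
  refine ⟨a, exists_path_of_walk (B := {z | x ∈ badBlock n L t z}) (j := j)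
    (f := fun i => (((next C)^[i] p).1.1 / L, ((next C)^[i] p).1.2 / L)) ?_ ?_ ?_ ?_⟩
  · intro i
    rw [mem_square, Function.iterate_succ_apply']
    have h := next_fst_sub_le (C := C) (iterate_next_mem hp i).1
    exact NearBlock.of_close (u := ((next C)^[i] p).1) (by omega) ⟨rfl, rfl⟩
      (h.1.trans (by omega)) (h.2.trans (by omega))
  · intro i
    set p' := (next C)^[i] p with hp'
    have hp'm : p' ∈ boundary C := iterate_next_mem hp i
    set z : ℤ × ℤ := (p'.1.1 / L, p'.1.2 / L) with hz
    change x ∈ badBlock n L t z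
    -- Near a good block all clocks have rung and all constraints are 3, so the `n + 1` boundary
    -- edges from `p'` on are blocked. They form a realised contour starting in the block, which
    -- makes it bad.
    by_contra hbad
    simp only [badBlock, Set.mem_ofPred_eq, not_or] at hbad
    obtain ⟨hcl, hco⟩ := hbad
    simp only [badClocks, badConstraints, Set.mem_ofPred_eq, not_or, not_exists, not_and,
      not_not, not_lt] at hcl hco
    obtain ⟨hext, hcl⟩ := hcl
    have hnear : ∀ k ≤ n, NearBlock L z ((next C)^[k] p').1 ∧
        NearBlock L z (((next C)^[k] p').1 + ((next C)^[k] p').2) := by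
      intro k hk
      have h1 := iterate_next_sub_le hp'm k
      have h2 := (iterate_next_mem hp'm k).1
      have h3 : |((next C)^[k] p').2.1| ≤ 1 ∧ |((next C)^[k] p').2.2| ≤ 1 := by
        rcases isDir_iff.1 h2 with h | h | h | h <;> simp [h]
      simp only [abs_le] at h1 h3
      constructor <;>
        refine NearBlock.of_close (u := p'.1) (by omega) ⟨rfl, rfl⟩ ?_ ?_ <;>
        rw [abs_le] <;> (try simp only [Prod.fst_add, Prod.snd_add]) <;> omega
    -- The segment has half-length `n + 1` so that no boundary edge recurs within `n` steps.
    have hne := iterate_next_ne hp (N := n + 1) (n := n) (by omega) (by push_cast; omega)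
      (m := j) (by push_cast; omega) i
    obtain ⟨b, hb⟩ := extends_of_boundary (U := x.1) (n := n) hp'm hne fun k hk => by
      have hm := iterate_next_mem hp'm k
      refine fits_and_blocks hwf hC hm (hcl _ ?_) (hco _ (hnear k hk).1) (hco _ (hnear k hk).2)
      intro v hv
      rw [edgeAt_val hm.1, Sym2.mem_iff] at hv
      rcases hv with rfl | rfl
      exacts [(hnear k hk).1, (hnear k hk).2]
    exact hext p' ⟨rfl, rfl⟩ hp'm.1 b hb
  · simp [ha, hp2]
  · exact Int.ediv_neg_of_neg_of_pos (by omega) hL0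

/-- A path from `(a, 0)` has `a + 1` blocks and at most 9^a shapes; summing over `a` gives (1/100) /
(1 - 9/100) = 1/91. -/
theorem environment_finite_segmentCluster_lt {ρ : PMF (Fin 4)} {n L : ℕ} (hL : n + 2 ≤ L) {t : ℝ}
    (hB : ∀ l : List (ℤ × ℤ), l.Nodup →
      environment ρ {x | ∀ z ∈ l, x ∈ badBlock n L t z} ≤ ENNReal.ofReal (1 / 100) ^ l.length) :
    environment ρ {x | WellFounded (Earlier x.1) ∧
      (segmentCluster (n + 1) (config t x)).Finite} < 1 := by
  calc _ ≤ environment ρ (⋃ a : ℕ, {x | ∃ l : List (ℤ × ℤ), l.length = a ∧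
        (l ++ [((a : ℤ), 0)]).IsChain (fun z w => z ∈ square w) ∧
        (l ++ [((a : ℤ), 0)]).Nodup ∧ ∀ z ∈ l ++ [((a : ℤ), 0)], x ∈ badBlock n L t z}) := by
        refine measure_mono fun x hx => ?_
        exact Set.mem_iUnion.2 (exists_badBlock_path hL hx.1 hx.2)
    _ ≤ ∑' a : ℕ, ENNReal.ofReal (1 / 100) * ENNReal.ofReal (9 / 100) ^ a := by
        refine (measure_iUnion_le _).trans (ENNReal.tsum_le_tsum fun a => ?_)
        refine (measure_exists_path_le _ (fun z => (card_square z).le) hB a ((a : ℤ), 0) []).trans ?_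
        have h9 : ((9 : ℕ) : ENNReal) = ENNReal.ofReal 9 := by simp
        rw [List.length_nil, add_zero, pow_succ, ← mul_assoc, ← mul_pow, h9,
          ← ENNReal.ofReal_mul (by norm_num), mul_comm]
        norm_num
    _ = ENNReal.ofReal (1 / 91) := by
        rw [ENNReal.tsum_mul_left, ENNReal.tsum_geometric, ← ENNReal.ofReal_one,
          ← ENNReal.ofReal_sub _ (by norm_num), ← ENNReal.ofReal_inv_of_pos (by norm_num),
          ← ENNReal.ofReal_mul (by norm_num)]
        norm_num
    _ < 1 := by rw [ENNReal.ofReal_lt_one]; norm_num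

/-- With positive probability some cluster near the origin is infinite. -/
theorem exists_environment_infinite_cluster_pos {ρ : PMF (Fin 4)} {n L : ℕ} (hL : n + 2 ≤ L)
    {t : ℝ} (hB : ∀ l : List (ℤ × ℤ), l.Nodup →
      environment ρ {x | ∀ z ∈ l, x ∈ badBlock n L t z} ≤ ENNReal.ofReal (1 / 100) ^ l.length) :
    ∃ u : ℤ × ℤ, 0 < environment ρ {x | (cluster (config t x) u).Infinite} := by
  -- Otherwise almost surely every cluster is finite, and then so is `segmentCluster`, a finite
  -- union of clusters.
  by_contra! h
  have : IsProbabilityMeasure (environment ρ) := by unfold environment; infer_instance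
  have hfin := environment_finite_segmentCluster_lt hL hB
  refine hfin.ne ?_
  have hall : ∀ᵐ x ∂environment ρ, ∀ u, (cluster (config t x) u).Finite :=
    ae_all_iff.2 fun u => by
      simpa [ae_iff, Set.not_infinite, ← Set.not_finite] using h u
  rw [← measure_univ (μ := environment ρ)]
  refine measure_congr (Filter.eventuallyEq_univ.2 ?_)
  filter_upwards [environment_fst (ρ := ρ) ae_wellFounded, hall] with x hwf hx
  refine ⟨hwf, ((Finset.Icc (-(n + 1 : ℤ)) (n + 1)).finite_toSet.biUnion
    fun a _ => hx (a, 0)).subset ?_⟩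
  rintro w ⟨a, ha, hw⟩
  rw [abs_le] at ha
  exact Set.mem_biUnion (x := a) (by push_cast at ha; simpa using ha) hw

/-! ### Translation invariance. -/

/-- Translation of the square lattice. -/
def shift (u : ℤ × ℤ) : lattice ≃g lattice where
  toEquiv := Equiv.addRight u
  map_rel_iff' := by simp [lattice]

/-- Translation of edges. -/
def shiftEdge (u : ℤ × ℤ) : Edge ≃ Edge := (shift u).mapEdgeSet

theorem shiftEdge_val (u : ℤ × ℤ) (e : Edge) : (shiftEdge u e).1 = e.1.map (· + u) := rfl

theorem add_mem_shiftEdge {u v : ℤ × ℤ} {e : Edge} : v + u ∈ (shiftEdge u e).1 ↔ v ∈ e.1 := by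
  simp [shiftEdge_val, Sym2.mem_map]

/-- Translation of the environment. -/
def shiftEnv (u : ℤ × ℤ) (x : Clocks × Constraints) : Clocks × Constraints :=
  (fun e => x.1 (shiftEdge u e), fun v => x.2 (v + u))

theorem measurePreserving_shiftEnv (ρ : PMF (Fin 4)) (u : ℤ × ℤ) :
    MeasurePreserving (shiftEnv u) (environment ρ) (environment ρ) :=
  MeasurePreserving.prod (f := fun (U : Clocks) e => U (shiftEdge u e))
    (g := fun (κ : Constraints) v => κ (v + u))
    ⟨by fun_prop, Measure.map_infinitePi_infinitePi_of_inj (shiftEdge u).injective⟩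
    ⟨by fun_prop, Measure.map_infinitePi_infinitePi_of_inj (add_left_injective u)⟩

theorem wellFounded_shiftEnv {x : Clocks × Constraints} (h : WellFounded (Earlier x.1))
    (u : ℤ × ℤ) : WellFounded (Earlier (shiftEnv u x).1) := by
  refine Subrelation.wf (r := InvImage (Earlier x.1) (shiftEdge u)) ?_ (InvImage.wf _ h)
  rintro f e ⟨⟨v, hf, he⟩, hlt⟩
  exact ⟨⟨v + u, add_mem_shiftEdge.2 hf, add_mem_shiftEdge.2 he⟩, hlt⟩

/-- Induction along the clock order: the rule involves only incidences, clock comparisons and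
constraints, all of which translation respects. -/
theorem succeeds_shiftEnv {x : Clocks × Constraints} (h : WellFounded (Earlier x.1))
    (u : ℤ × ℤ) (e : Edge) :
    Succeeds (shiftEnv u x).1 (shiftEnv u x).2 e ↔ Succeeds x.1 x.2 (shiftEdge u e) := by
  have h' := wellFounded_shiftEnv h u
  induction e using h'.induction with
  | _ e ih =>
    rw [succeeds_iff h', succeeds_iff h]
    have hset : ∀ v ∈ e.1,
        {f : Edge | ∃ (_ : v ∈ f.1) (_ : (shiftEnv u x).1 f < (shiftEnv u x).1 e),
          Succeeds (shiftEnv u x).1 (shiftEnv u x).2 f}.encard =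
        {f : Edge | ∃ (_ : v + u ∈ f.1) (_ : x.1 f < x.1 (shiftEdge u e)),
          Succeeds x.1 x.2 f}.encard := by
      intro v hv
      rw [← Set.encard_preimage_of_bijective (shiftEdge u).bijective
        {f : Edge | ∃ (_ : v + u ∈ f.1) (_ : x.1 f < x.1 (shiftEdge u e)), Succeeds x.1 x.2 f}]
      congr 1
      ext f
      simp only [Set.mem_ofPred_eq, Set.mem_preimage, add_mem_shiftEdge, exists_prop]
      refine and_congr_right fun hf => and_congr_right fun hlt => ?_
      exact ih f ⟨⟨v, hf, hv⟩, hlt⟩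
    unfold rule
    constructor
    · intro H w hw
      obtain ⟨v, rfl⟩ : ∃ v, w = v + u := ⟨w - u, by simp⟩
      have hv := add_mem_shiftEdge.1 hw
      rw [← hset v hv]
      exact H v hv
    · intro H v hv
      rw [hset v hv]
      exact H (v + u) (add_mem_shiftEdge.2 hv)

theorem config_shiftEnv {t : ℝ} {x : Clocks × Constraints} (h : WellFounded (Earlier x.1))
    (u : ℤ × ℤ) (e : Edge) : config t (shiftEnv u x) e = config t x (shiftEdge u e) := by
  rw [Bool.eq_iff_iff]
  simp only [config, decide_eq_true_eq, succeeds_shiftEnv h]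
  rfl

theorem cluster_shiftEnv {t : ℝ} {x : Clocks × Constraints} (h : WellFounded (Earlier x.1))
    (u v : ℤ × ℤ) :
    cluster (config t (shiftEnv u x)) v = (· + u) ⁻¹' cluster (config t x) (v + u) := by
  let φ : openGraph (config t (shiftEnv u x)) ≃g openGraph (config t x) :=
    { toEquiv := Equiv.addRight u
      map_rel_iff' := by
        intro v w
        constructor
        · rintro ⟨hadj, ho⟩
          refine ⟨(shift u).map_rel_iff.1 hadj, ?_⟩
          rw [config_shiftEnv h]
          exact ho
        · rintro ⟨hadj, ho⟩
          refine ⟨(shift u).map_rel_iff.2 hadj, ?_⟩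
          rw [config_shiftEnv h] at ho
          exact ho }
  ext w
  exact (SimpleGraph.Iso.reachable_iff (φ := φ)).symm

/-- All vertices have the same percolation probability. -/
theorem environment_infinite_cluster_le (ρ : PMF (Fin 4)) (t : ℝ) (u : ℤ × ℤ) :
    environment ρ {x | (cluster (config t x) u).Infinite} ≤
      environment ρ {x | (cluster (config t x) (0, 0)).Infinite} := by
  have hmp := measurePreserving_shiftEnv ρ u
  calc _ ≤ environment ρ (shiftEnv u ⁻¹' {x | (cluster (config t x) (0, 0)).Infinite}) := by
        refine measure_mono_ae ?_
        filter_upwards [environment_fst (ρ := ρ) ae_wellFounded] with x hwf hx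
        change (cluster (config t (shiftEnv u x)) (0, 0)).Infinite
        rw [cluster_shiftEnv hwf, show ((0, 0) : ℤ × ℤ) + u = u from zero_add u]
        exact Set.Infinite.preimage hx (by
          simp [show Set.range (· + u) = Set.univ from (Equiv.addRight u).surjective.range_eq])
    _ ≤ (environment ρ).map (shiftEnv u) {x | (cluster (config t x) (0, 0)).Infinite} :=
        Measure.le_map_apply hmp.measurable.aemeasurable _
    _ = _ := by rw [hmp.map_eq]

end CDP

/-! ### Conclusion. -/

open CDP MeasureTheory in
theorem theorem1p1 :
    ∃ η : ℝ, 0 < η ∧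
      ∀ (ρ : PMF (Fin 4)) (t : ℝ),
        (ρ 3).toReal ∈ Set.Ioc (1 - η) 1 → t ∈ Set.Ioc (1 - η) 1 →
          0 < CDP.law ρ t CDP.originPercolates := by
  -- Path counting needs 9q < 1, met by q = 1/100; the two sources of badness and the nine residue
  -- classes then ask for ε = q⁹/2.
  obtain ⟨n, η, hη, h⟩ := exists_badBlock_bound (ε := (1 / 100) ^ 9 / 2) (by norm_num)
  refine ⟨η, hη, fun ρ t hρ ht => ?_⟩
  have hb := h ρ t hρ.1 ht.1
  obtain ⟨u, hu⟩ := exists_environment_infinite_cluster_pos le_rfl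
    (environment_badBlock_le (ρ := ρ) le_rfl (fun z => (hb z).1) (fun z => (hb z).2)
      (q := ENNReal.ofReal (1 / 100)) (by
        rw [← ENNReal.ofReal_add (by norm_num) (by norm_num),
          ← ENNReal.ofReal_pow (by norm_num), add_halves])
      (by rw [ENNReal.ofReal_le_one]; norm_num))
  -- Only the inequality `Measure.le_map_apply` is used, so measurability of `originPercolates` is
  -- not needed.
  exact hu.trans_le ((environment_infinite_cluster_le ρ t u).trans
    (Measure.le_map_apply (aemeasurable_config ρ t) originPercolates))
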